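/- **Setting.** Let $M$ be an integer $d\times d$ dilation matrix (all eigenvalues have modulus $>1$), $m=|\det M|$, $M^*=M^{T}$. Let $D=\{s_0=\mathbf 0,s_1,\dots,s_{m-1}\}\subset\mathbb Z^d$ and $D^*=\{s_0^*=\mathbf 0,\dots,s^*_{m-1}\}\subset\mathbb Z^d$ be sets of digits for $M$ and $M^*$, i.e. pairwise incongruent modulo $M\mathbb Z^d$, resp. $M^*\mathbb Z^d$. Let $V$ be the generalized Vilenkin group of all sequences $x=(x_j)_{j\in\mathbb Z}$, $x_j\in D$, having only finitely many nonzero $x_j$ with $j<0$, with coordinatewise addition $\oplus$ modulo $M$, the topology with the base $U_l=\{x: x_j=\mathbf 0\ \forall j\le l\}$, $l\in\mathbb Z$, of neighbourhoods of zero, and the Haar measure $\mu$ normalized by $\mu(U_0)=1$; put $U=U_0$, $(\mathcal Mx)_j=x_{j+1}$, $H=\{x\in V:x_j=\mathbf 0\ \forall j>0\}$. For $k\in\mathbb Z_+$ with base-$m$ expansion $k=\sum_{j\ge 0} k_jm^j$ let $\gamma_{[k]}\in H$ have the coordinates $(\gamma_{[k]})_{-j}=s_{k_j}$, $j\ge0$,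 and let $U_{l,k}=\mathcal M^{-l}\gamma_{[k]}\oplus\mathcal M^{-l}(U)$. Let $\mathcal S_l^{(k)}$ be the class of functions $V\to\mathbb C$ that vanish outside $\mathcal M^k(U)$ and are constant on each of the sets $U_{l,i}$, $i\in\mathbb Z_+$. Denote by $V^*,U_l^*,\mathcal M^*,\mu^*$ the same objects for $M^*,D^*$. For $x\in V$, $\omega\in V^*$ let $\chi(x,\omega)=\exp\bigl(2\pi i\sum_{j\in\mathbb Z}\langle M^{-1}x_j,\omega_{1-j}\rangle\bigr)$; the Fourier transform is $\widehat f(\omega)=\int_V f(x)\overline{\chi(x,\omega)}\,d\mu(x)$ for $f\in L_1(V)$, extended to $L_2(V)$ by $L_2$-limits. A Walsh polynomial of order $n$ is a linear combination of the functions $\chi(\gamma_{[k]},\cdot)$, $0\le k<m^n$, on $V^*$. A function $\varphi\in L_2(V)$ is refinable if $\varphi(x)=\sum_{k\ge 0}\alpha_k\varphi(\mathcal Mx\oplus\gamma_{[k]})$ a.e. for some numbers $\alpha_k$; it is orthogonal if moreover $\{\varphi(\cdot\oplus h): h\in H\}$ is orthonormal in $L_2(V)$. We write $\omega_{-N}\dots\omega_0\boldsymbol{,}\,\omega_1\dots\omega_l$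 for the element of $V^*$ with these coordinates and all others $\mathbf 0$. **Theorem.** Let $n,r\in\mathbb N$, $r\ge n\ge 2$, and let $\xi_0,\dots,\xi_r\in D^*\setminus\{\mathbf 0\}$ be such that $(\xi_k,\dots,\xi_{k+n-2})\ne(\xi_{k'},\dots,\xi_{k'+n-2})$ for all $0\le k<k'\le r-n+2$. Let $b:(D^*)^n\to\mathbb C$ satisfy: $b(\xi_k\dots\xi_{k+n-1})\in\{1,-1\}$ for $k=0,\dots,r-n+1$; $b(\mathbf 0\,\omega_2\dots\omega_n)\in\{1,-1\}$ whenever $(\omega_2,\dots,\omega_n)\neq(\xi_k,\dots,\xi_{k+n-2})$ for all $k=1,\dots,r-n+2$; $b(\mathbf 0\dots\mathbf 0)=1$; and $b=0$ at all other words. Put $m_0(\omega)=b(\omega_1\dots\omega_n)$, $\omega\in V^*$. Then $m_0$ is a Walsh polynomial of order $n$, and there is a unique $\varphi\in L_2(V)$ with $$\widehat\varphi=\prod_{j=1}^\infty m_0\bigl((\mathcal M^{*})^{-j}\,\cdot\,\bigr).$$ This $\varphi$ is refinable and orthogonal, $\varphi\in\mathcal S^{(n-1)}_{r-n+2}$ (after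 correction on a null set), and for every $\omega\in V^*$ $$\widehat\varphi(\omega)=\sum_{k=1}^{r-n+2}\mathbf 1_{\xi_0\dots\xi_{k-1}\boldsymbol{,}\,\xi_k\dots\xi_{k+n-2}\oplus U^*_{n-1}}(\omega)\prod_{j=1}^{k+n-1}b(\xi_{k-j}\dots\xi_{k+n-1-j})+\mathbf 1_{Q\oplus U^*_{n-1}}(\omega)\prod_{j=1}^{n-1}b(\mathbf 0\dots\mathbf 0\,\omega_1\dots\omega_{n-j}),$$ where $\xi_l=\mathbf 0$ for $l\le-1$ and $$Q=\{\mathbf 0\boldsymbol{,}\,\alpha_1\dots\alpha_{n-1}:\ \alpha_i\in D^*,\ (\alpha_1,\dots,\alpha_{n-1})\ne(\xi_k,\dots,\xi_{k+n-2})\ \ \forall k=1,\dots,r-n+2\}.$$ -/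

import Mathlib

open MeasureTheory Filter Topology
open scoped Pointwise ComplexConjugate ENNReal

namespace GenVilenkin

/-- A dilation matrix: an integer matrix all of whose complex eigenvalues have modulus `> 1`. -/
def IsDilation {d : ℕ} (M : Matrix (Fin d) (Fin d) ℤ) : Prop :=
  ∀ z ∈ spectrum ℂ (M.map (fun a : ℤ => (a : ℂ))), 1 < ‖z‖

/-- `l ≡ k (mod M)`. -/
def Congruent {d : ℕ} (M : Matrix (Fin d) (Fin d) ℤ) (l k : Fin d → ℤ) : Prop :=
  ∃ s : Fin d → ℤ, l - k = M.mulVec s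

/-- A set of digits `s_0 = 0, s_1, …, s_{m-1}` for `M`, where `m = |det M|`: `m` integer vectors
that are pairwise incongruent modulo `M`. (The presence of `s_0` forces `m ≠ 0`.) -/
structure DigitSet {d : ℕ} (M : Matrix (Fin d) (Fin d) ℤ) where
  /-- the digits `s_0, …, s_{m-1}` -/
  digit : Fin M.det.natAbs → (Fin d → ℤ)
  exists_zero : ∃ i : Fin M.det.natAbs, i.val = 0 ∧ digit i = 0
  incongruent : ∀ i j, i ≠ j → ¬ Congruent M (digit i) (digit j)

/-- The sublattice `M ℤ^d` of `ℤ^d`. -/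
abbrev lattice {d : ℕ} (M : Matrix (Fin d) (Fin d) ℤ) : Submodule ℤ (Fin d → ℤ) :=
  LinearMap.range M.mulVecLin

section Digits

variable {d : ℕ} {M : Matrix (Fin d) (Fin d) ℤ}

theorem DigitSet.m_pos (D : DigitSet M) : 0 < M.det.natAbs := by
  obtain ⟨i, -, -⟩ := D.exists_zero
  exact lt_of_le_of_lt (Nat.zero_le _) i.isLt

theorem DigitSet.det_ne_zero (D : DigitSet M) : M.det ≠ 0 :=
  Int.natAbs_pos.mp D.m_pos

theorem card_quotient (hM : M.det ≠ 0) :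
    Nat.card ((Fin d → ℤ) ⧸ lattice M) = M.det.natAbs := by
  have hinj : Function.Injective M.mulVecLin := by
    intro x y hxy
    exact Matrix.mulVec_injective_of_det_ne_zero hM hxy
  let e : (Fin d → ℤ) ≃ₗ[ℤ] lattice M := LinearEquiv.ofInjective M.mulVecLin hinj
  rw [← Submodule.natAbs_det_equiv (lattice M) e]
  have : (lattice M).subtype ∘ₗ AddMonoidHom.toIntLinearMap (e : (Fin d → ℤ) →+ lattice M)
      = Matrix.toLin' M := by
    ext x
    rfl
  rw [this, LinearMap.det_toLin']

/-- The digit set `D` as a type: the integer vectors `s_0, …, s_{m-1}`. -/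
def Digit (D : DigitSet M) : Type := {v : Fin d → ℤ // v ∈ Set.range D.digit}

/-- The residue class modulo `M` of a digit. -/
def Digit.toQuotient {D : DigitSet M} (v : Digit D) : (Fin d → ℤ) ⧸ lattice M :=
  Submodule.Quotient.mk v.1

theorem Digit.toQuotient_bijective (D : DigitSet M) :
    Function.Bijective (Digit.toQuotient (D := D)) := by
  have key : ∀ i j, (Submodule.Quotient.mk (D.digit i) : (Fin d → ℤ) ⧸ lattice M)
      = Submodule.Quotient.mk (D.digit j) → i = j := by
    intro i j h
    by_contra hij
    rw [Submodule.Quotient.eq] at h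
    obtain ⟨s, hs⟩ := h
    exact D.incongruent i j hij ⟨s, hs.symm⟩
  have hcard := card_quotient D.det_ne_zero
  have : Finite ((Fin d → ℤ) ⧸ lattice M) :=
    Nat.finite_of_card_ne_zero (by rw [hcard]; exact D.m_pos.ne')
  have hsurj : Function.Surjective
      (fun i => (Submodule.Quotient.mk (D.digit i) : (Fin d → ℤ) ⧸ lattice M)) := by
    have hb := (Nat.bijective_iff_injective_and_card
      (fun i => (Submodule.Quotient.mk (D.digit i) : (Fin d → ℤ) ⧸ lattice M))).2
      ⟨fun i j h => key i j h, by simp [hcard]⟩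
    exact hb.2
  constructor
  · rintro ⟨_, i, rfl⟩ ⟨_, j, rfl⟩ h
    have := key i j h
    subst this
    rfl
  · intro q
    obtain ⟨i, hi⟩ := hsurj q
    exact ⟨⟨D.digit i, i, rfl⟩, hi⟩

/-- Digits correspond bijectively to the residue classes modulo `M`. -/
noncomputable def Digit.equivQuotient (D : DigitSet M) : Digit D ≃ ((Fin d → ℤ) ⧸ lattice M) :=
  Equiv.ofBijective _ (Digit.toQuotient_bijective D)

/-- Addition of digits modulo `M`: the sum of two digits is the digit congruent to their sum. -/
noncomputable instance (D : DigitSet M) : AddCommGroup (Digit D) :=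
  (Digit.equivQuotient D).addCommGroup

theorem Digit.add_congruent {D : DigitSet M} (u v : Digit D) :
    Congruent M (u + v).1 (u.1 + v.1) := by
  have h : Digit.toQuotient (u + v) = Digit.toQuotient u + Digit.toQuotient v :=
    (Digit.equivQuotient D).apply_symm_apply _
  have h' : (Submodule.Quotient.mk (u + v).1 : (Fin d → ℤ) ⧸ lattice M)
      = Submodule.Quotient.mk (u.1 + v.1) := h
  rw [Submodule.Quotient.eq] at h'
  obtain ⟨s, hs⟩ := h'
  exact ⟨s, hs.symm⟩

theorem Digit.zero_val (D : DigitSet M) : (0 : Digit D).1 = 0 := by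
  obtain ⟨i, -, hi⟩ := D.exists_zero
  have h : (0 : Digit D) = ⟨D.digit i, i, rfl⟩ := by
    apply (Digit.equivQuotient D).injective
    have h1 : Digit.equivQuotient D (0 : Digit D) = 0 :=
      (Digit.equivQuotient D).apply_symm_apply _
    rw [h1]
    change (0 : (Fin d → ℤ) ⧸ lattice M) = Submodule.Quotient.mk (D.digit i)
    rw [hi]
    rfl
  rw [h]
  exact hi

instance (D : DigitSet M) : Finite (Digit D) :=
  Set.finite_range D.digit

/-- The digit `s_i` with `i = k mod m`. -/
def DigitSet.nthDigit (D : DigitSet M) (k : ℕ) : Digit D :=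
  ⟨D.digit ⟨k % M.det.natAbs, Nat.mod_lt _ D.m_pos⟩, _, rfl⟩

theorem DigitSet.nthDigit_zero (D : DigitSet M) : D.nthDigit 0 = 0 := by
  obtain ⟨i, hi0, hi⟩ := D.exists_zero
  apply Subtype.ext
  rw [Digit.zero_val, ← hi]
  change D.digit _ = D.digit i
  congr 1
  apply Fin.ext
  simp [hi0]

end Digits

section Group

variable {d : ℕ} {M : Matrix (Fin d) (Fin d) ℤ}

/-- The sequences of digits indexed by `ℤ` with only finitely many nonzero entries at negative
places, as a subgroup of all sequences under coordinatewise addition modulo `M`. -/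
def seqSubgroup (D : DigitSet M) : AddSubgroup (ℤ → Digit D) where
  carrier := {x | ∃ N : ℤ, ∀ j < N, x j = 0}
  zero_mem' := ⟨0, fun _ _ => rfl⟩
  add_mem' := by
    rintro x y ⟨N, hN⟩ ⟨K, hK⟩
    refine ⟨min N K, fun j hj => ?_⟩
    rw [Pi.add_apply, hN j (lt_of_lt_of_le hj (min_le_left _ _)),
      hK j (lt_of_lt_of_le hj (min_le_right _ _)), add_zero]
  neg_mem' := by
    rintro x ⟨N, hN⟩
    refine ⟨N, fun j hj => ?_⟩
    rw [Pi.neg_apply, hN j hj, neg_zero]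

/-- The generalized Vilenkin group `V` associated with the matrix `M` and the digit set `D`. -/
def Vilenkin (D : DigitSet M) : Type := seqSubgroup D

noncomputable instance (D : DigitSet M) : AddCommGroup (Vilenkin D) :=
  inferInstanceAs (AddCommGroup (seqSubgroup D))

instance (D : DigitSet M) : CoeFun (Vilenkin D) (fun _ => ℤ → Digit D) := ⟨fun x => x.1⟩

/-- The subgroups `U_l = {x : x_j = 0 for all j ≤ l}`. -/
def U (D : DigitSet M) (l : ℤ) : Set (Vilenkin D) := {x | ∀ j ≤ l, x j = 0}

/-- The topology for which the sets `U_l`, `l ∈ ℤ`, form a base of neighbourhoods of zero. -/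
instance (D : DigitSet M) : TopologicalSpace (Vilenkin D) where
  IsOpen S := ∀ x ∈ S, ∃ l : ℤ, ∀ u ∈ U D l, x + u ∈ S
  isOpen_univ := fun _ _ => ⟨0, fun _ _ => trivial⟩
  isOpen_inter := by
    rintro S T hS hT x ⟨hxS, hxT⟩
    obtain ⟨l, hl⟩ := hS x hxS
    obtain ⟨k, hk⟩ := hT x hxT
    exact ⟨max l k, fun u hu =>
      ⟨hl u fun j hj => hu j (hj.trans (le_max_left _ _)),
        hk u fun j hj => hu j (hj.trans (le_max_right _ _))⟩⟩
  isOpen_sUnion := by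
    rintro s hs x ⟨t, ht, hxt⟩
    obtain ⟨l, hl⟩ := hs t ht x hxt
    exact ⟨l, fun u hu => ⟨t, ht, hl u hu⟩⟩

theorem isOpen_iff {D : DigitSet M} {S : Set (Vilenkin D)} :
    IsOpen S ↔ ∀ x ∈ S, ∃ l : ℤ, ∀ u ∈ U D l, x + u ∈ S := Iff.rfl

theorem add_mem_U {D : DigitSet M} {l : ℤ} {u v : Vilenkin D} (hu : u ∈ U D l) (hv : v ∈ U D l) :
    u + v ∈ U D l := fun j hj => by
  change u j + v j = 0
  rw [hu j hj, hv j hj, add_zero]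

theorem neg_mem_U {D : DigitSet M} {l : ℤ} {u : Vilenkin D} (hu : u ∈ U D l) :
    -u ∈ U D l := fun j hj => by
  change -(u j) = 0
  rw [hu j hj, neg_zero]

theorem zero_mem_U (D : DigitSet M) (l : ℤ) : (0 : Vilenkin D) ∈ U D l := fun _ _ => rfl

theorem isOpen_coset {D : DigitSet M} (x : Vilenkin D) (l : ℤ) :
    IsOpen {y : Vilenkin D | y - x ∈ U D l} := by
  rw [isOpen_iff]
  intro y hy
  refine ⟨l, fun u hu => ?_⟩
  have : y + u - x = (y - x) + u := by abel
  change y + u - x ∈ U D l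
  rw [this]
  exact add_mem_U hy hu

theorem isOpen_U (D : DigitSet M) (l : ℤ) : IsOpen (U D l) := by
  simpa using isOpen_coset (0 : Vilenkin D) l

instance (D : DigitSet M) : IsTopologicalAddGroup (Vilenkin D) where
  continuous_add := by
    rw [continuous_def]
    intro S hS
    rw [isOpen_prod_iff]
    intro a b hab
    obtain ⟨l, hl⟩ := isOpen_iff.1 hS _ hab
    refine ⟨_, _, isOpen_coset a l, isOpen_coset b l, ?_, ?_, ?_⟩
    · simpa using zero_mem_U D l
    · simpa using zero_mem_U D l
    · rintro ⟨y, z⟩ ⟨hy, hz⟩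
      have := hl _ (add_mem_U hy hz)
      have e : a + b + (y - a + (z - b)) = y + z := by abel
      simp only [e] at this
      exact this
  continuous_neg := by
    rw [continuous_def]
    intro S hS
    rw [isOpen_iff]
    intro x hx
    obtain ⟨l, hl⟩ := isOpen_iff.1 hS _ hx
    refine ⟨l, fun u hu => ?_⟩
    have := hl _ (neg_mem_U hu)
    change -(x + u) ∈ S
    rwa [neg_add]

theorem isCompact_U_zero (D : DigitSet M) : IsCompact (U D 0) := by
  let _ : TopologicalSpace (Digit D) := ⊥
  have : DiscreteTopology (Digit D) := ⟨rfl⟩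
  let F : (ℕ → Digit D) → Vilenkin D := fun a =>
    ⟨fun j => if 0 < j then a j.toNat else 0, 0, fun j hj => if_neg (by omega)⟩
  have hF : Continuous F := by
    rw [continuous_def]
    intro S hS
    rw [isOpen_iff_mem_nhds]
    intro a ha
    obtain ⟨l, hl⟩ := isOpen_iff.1 hS _ ha
    have hopen : IsOpen (⋂ i ∈ Finset.range (l.toNat + 1),
        {c : ℕ → Digit D | c i = a i}) := by
      apply isOpen_biInter_finset
      intro i _
      exact (isOpen_discrete ({a i} : Set (Digit D))).preimage
        (continuous_apply (A := fun _ : ℕ => Digit D) i)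
    refine mem_of_superset (hopen.mem_nhds (by simp)) ?_
    intro c hc
    simp only [Set.mem_iInter, Set.mem_ofPred_eq, Finset.mem_range] at hc
    have hu : F c - F a ∈ U D l := by
      intro j hj
      change (if 0 < j then c j.toNat else 0) - (if 0 < j then a j.toNat else 0) = 0
      split_ifs with h
      · rw [hc j.toNat (by omega), sub_self]
      · rw [sub_self]
    have := hl _ hu
    rw [add_sub_cancel] at this
    exact this
  have hU : U D 0 = Set.range F := by
    ext x
    constructor
    · intro hx
      refine ⟨fun i => x i, ?_⟩
      apply Subtype.ext
      funext j
      change (if 0 < j then x ((j.toNat : ℕ) : ℤ) else 0) = x j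
      split_ifs with h
      · rw [Int.toNat_of_nonneg h.le]
      · exact (hx j (by omega)).symm
    · rintro ⟨a, rfl⟩ j hj
      exact if_neg (by omega)
  rw [hU]
  exact isCompact_range hF

instance (D : DigitSet M) : MeasurableSpace (Vilenkin D) := borel _

instance (D : DigitSet M) : BorelSpace (Vilenkin D) := ⟨rfl⟩

/-- `U = U_0` as a compact set with nonempty interior. -/
def compactU (D : DigitSet M) : TopologicalSpace.PositiveCompacts (Vilenkin D) where
  carrier := U D 0
  isCompact' := isCompact_U_zero D
  interior_nonempty' := by
    rw [(isOpen_U D 0).interior_eq]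
    exact ⟨0, zero_mem_U D 0⟩

/-- The Haar measure on `V`, normalized by `μ U = 1`. -/
noncomputable def haar (D : DigitSet M) : Measure (Vilenkin D) :=
  Measure.addHaarMeasure (compactU D)

theorem haar_U (D : DigitSet M) : haar D (U D 0) = 1 :=
  Measure.addHaarMeasure_self (K₀ := compactU D)

instance (D : DigitSet M) : (haar D).IsAddHaarMeasure :=
  inferInstanceAs ((Measure.addHaarMeasure (compactU D)).IsAddHaarMeasure)

/-- The power `𝓜^k`, `k ∈ ℤ`, of the shift `𝓜` with `(𝓜 x)_j = x_{j+1}`. -/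
def dil {D : DigitSet M} (k : ℤ) (x : Vilenkin D) : Vilenkin D :=
  ⟨fun j => x (j + k), by
    obtain ⟨N, hN⟩ := x.2
    exact ⟨N - k, fun j hj => hN (j + k) (by omega)⟩⟩

/-- `H = {x ∈ V : x_j = 0 for all j > 0}`. -/
def H (D : DigitSet M) : Set (Vilenkin D) := {x | ∀ j > 0, x j = 0}

/-- The element `γ_[k] ∈ H`: `(γ_[k])_{-j} = s_{k_j}` where `k = ∑_j k_j m^j` is the base-`m`
expansion of `k`. -/
noncomputable def gam (D : DigitSet M) (k : ℕ) : Vilenkin D :=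
  ⟨fun j => if 0 < j then 0 else D.nthDigit (k / M.det.natAbs ^ (-j).toNat), by
    refine ⟨-(k : ℤ), fun j hj => ?_⟩
    beta_reduce
    rw [if_neg (by omega)]
    rcases Nat.lt_or_ge 1 M.det.natAbs with h | h
    · have : k < M.det.natAbs ^ (-j).toNat :=
        lt_of_lt_of_le (by omega : k < (-j).toNat) (Nat.lt_pow_self h).le
      rw [Nat.div_eq_of_lt this]
      exact D.nthDigit_zero
    · have h1 : M.det.natAbs = 1 := le_antisymm h D.m_pos
      rw [← D.nthDigit_zero]
      apply Subtype.ext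
      change D.digit _ = D.digit _
      congr 1
      apply Fin.ext
      simp [h1, Nat.mod_one]⟩

/-- `U_{n,k} = 𝓜^{-n} γ_[k] ⊕ 𝓜^{-n}(U)`. -/
def Unk (D : DigitSet M) (n : ℤ) (k : ℕ) : Set (Vilenkin D) :=
  {dil (-n) (gam D k)} + dil (-n) '' U D 0

/-- The class `𝓢_n(V)` of functions that are constant on each `U_{n,k}`. -/
def StepFun (D : DigitSet M) (n : ℤ) : Set (Vilenkin D → ℂ) :=
  {f | ∀ k : ℕ, ∀ x ∈ Unk D n k, ∀ x' ∈ Unk D n k, f x = f x'}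

/-- The class `𝓢_n^{(k)}(V)` of the functions in `𝓢_n(V)` supported in `𝓜^k(U)`. -/
def TestFun (D : DigitSet M) (n k : ℤ) : Set (Vilenkin D → ℂ) :=
  {f | f ∈ StepFun D n ∧ Function.support f ⊆ dil k '' U D 0}

/-- The space `L_2(V)`. -/
noncomputable abbrev L2 (D : DigitSet M) := Lp ℂ 2 (haar D)

/-- The translate `φ(· ⊕ h)` of `φ ∈ L_2(V)`. -/
noncomputable def translate {D : DigitSet M} (φ : L2 D) (h : Vilenkin D) : L2 D :=
  Lp.compMeasurePreserving (fun x => x + h) (measurePreserving_add_right (haar D) h) φ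

/-- `φ ∈ L_2(V)` is refinable: `φ(x) = ∑_k α_k φ(𝓜 x ⊕ γ_[k])` for some numbers `α_k`
(for almost every `x`, the elements of `L_2(V)` being classes of functions). -/
def IsRefinable {D : DigitSet M} (φ : L2 D) : Prop :=
  ∃ α : ℕ → ℂ, ∀ᵐ x ∂(haar D), HasSum (fun k => α k * φ (dil 1 x + gam D k)) (φ x)

/-- An orthogonal refinable function: the translates `φ(· ⊕ h)`, `h ∈ H`, are orthonormal. -/
def IsOrthogonalRefinable {D : DigitSet M} (φ : L2 D) : Prop :=
  IsRefinable φ ∧ Orthonormal ℂ (fun h : H D => translate φ h.1)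

end Group

section Fourier

variable {d : ℕ} {M : Matrix (Fin d) (Fin d) ℤ}

/-- The number `⟨M⁻¹ x, w⟩` for integer vectors `x`, `w`. -/
noncomputable def pairing (M : Matrix (Fin d) (Fin d) ℤ) (x w : Fin d → ℤ) : ℝ :=
  ((M.map (fun a : ℤ => (a : ℝ)))⁻¹.mulVec fun i => (x i : ℝ)) ⬝ᵥ fun i => (w i : ℝ)

/-- `χ(x, ω) = exp (2πi ∑_{j ∈ ℤ} ⟨M⁻¹ x_j, ω_{1-j}⟩)`, `x ∈ V`, `ω ∈ V*`; the group `V*` is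
associated with `Mᵀ` and a digit set of `Mᵀ`. Only finitely many terms of the sum are nonzero. -/
noncomputable def chi {D : DigitSet M} {Ds : DigitSet M.transpose}
    (x : Vilenkin D) (ω : Vilenkin Ds) : ℂ :=
  Complex.exp (2 * Real.pi * Complex.I * ((∑ᶠ j : ℤ, pairing M (x j).1 (ω (1 - j)).1 : ℝ) : ℂ))

/-- The Fourier transform of an integrable function on `V`. -/
noncomputable def fourier {D : DigitSet M} (Ds : DigitSet M.transpose) (f : Vilenkin D → ℂ)
    (ω : Vilenkin Ds) : ℂ :=
  ∫ x, f x * conj (chi x ω) ∂(haar D)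

/-- `g` is (a representative of) the Fourier transform of `f ∈ L_2(V)`: the extension of the
Fourier transform from `L_1 ∩ L_2` to `L_2` by `L_2`-limits. -/
def IsFourierL2 {D : DigitSet M} {Ds : DigitSet M.transpose} (f : L2 D) (g : Vilenkin Ds → ℂ) :
    Prop :=
  MemLp g 2 (haar Ds) ∧ ∃ u : ℕ → L2 D, (∀ k, Integrable (u k) (haar D)) ∧
    Tendsto u atTop (𝓝 f) ∧
    Tendsto (fun k => eLpNorm (fun ω => fourier Ds (u k) ω - g ω) 2 (haar Ds)) atTop (𝓝 0)

/-- Walsh polynomials of order `n`: linear combinations of the Walsh functions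
`W_k = χ(γ_[k], ·)`, `0 ≤ k < m^n`. -/
def IsWalshPolynomial (D : DigitSet M) (Ds : DigitSet M.transpose) (n : ℕ)
    (p : Vilenkin Ds → ℂ) : Prop :=
  ∃ β : ℕ → ℂ, ∀ ω, p ω = ∑ k ∈ Finset.range (M.det.natAbs ^ n), β k * chi (gam D k) ω

end Fourier

section Mask

variable {d : ℕ} {A : Matrix (Fin d) (Fin d) ℤ} {Ds : DigitSet A} {n r : ℕ}

/-- The sequence `ξ_0, …, ξ_r` extended to all integer indices by zero digits. -/
noncomputable def ext (ξ : Fin (r + 1) → Digit Ds) (l : ℤ) : Digit Ds :=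
  if h : 0 ≤ l ∧ l ≤ r then ξ ⟨l.toNat, by omega⟩ else 0

/-- The word `a_s a_{s+1} … a_{s+n-1}` of length `n`. -/
def word (n : ℕ) (a : ℤ → Digit Ds) (s : ℤ) : Fin n → Digit Ds := fun i => a (s + (i.val : ℤ))

/-- All windows `(ξ_k, …, ξ_{k+n-2})`, `0 ≤ k ≤ r-n+2`, of length `n-1` are distinct. -/
def DistinctWindows (n : ℕ) (ξ : Fin (r + 1) → Digit Ds) : Prop :=
  ∀ k k' : ℕ, k + n ≤ r + 2 → k' + n ≤ r + 2 → k ≠ k' →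
    word (n - 1) (ext ξ) k ≠ word (n - 1) (ext ξ) k'

/-- `ω_1 … ω_n = ξ_k … ξ_{k+n-1}` for some `k = 0, …, r-n+1`. -/
def IsChainWord (ξ : Fin (r + 1) → Digit Ds) (w : Fin n → Digit Ds) : Prop :=
  ∃ k : ℕ, k + n ≤ r + 1 ∧ w = word n (ext ξ) k

/-- `ω_1 = 0`, and `(ω_2, …, ω_n)` is different from `(ξ_k, …, ξ_{k+n-2})` for all
`k = 1, …, r-n+2`. -/
def IsZeroWord (ξ : Fin (r + 1) → Digit Ds) (w : Fin n → Digit Ds) : Prop :=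
  (∀ i : Fin n, i.val = 0 → w i = 0) ∧
    ∀ k : ℕ, 1 ≤ k → k + n ≤ r + 2 →
      (fun i : Fin (n - 1) => w ⟨i.val + 1, by omega⟩) ≠ word (n - 1) (ext ξ) k

/-- The values `b(ω_1 … ω_n)` of a mask associated with `ξ_0, …, ξ_r`. -/
structure IsAssociatedMask (ξ : Fin (r + 1) → Digit Ds) (b : (Fin n → Digit Ds) → ℂ) : Prop where
  chain : ∀ w, IsChainWord ξ w → b w = 1 ∨ b w = -1
  zeroFirst : ∀ w, IsZeroWord ξ w → b w = 1 ∨ b w = -1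
  zero : b (fun _ => 0) = 1
  other : ∀ w, ¬ IsChainWord ξ w → ¬ IsZeroWord ξ w → b w = 0

/-- The function `m_0(ω) = b(ω_1 … ω_n)`. -/
def mask (b : (Fin n → Digit Ds) → ℂ) (ω : Vilenkin Ds) : ℂ := b (word n ω 1)

/-- The product `∏_{j=1}^∞ m_0(𝓜*^{-j} ω)`. -/
noncomputable def maskProd (b : (Fin n → Digit Ds) → ℂ) (ω : Vilenkin Ds) : ℂ :=
  ∏' j : ℕ, mask b (dil (-((j : ℤ) + 1)) ω)

/-- The element `ξ_0 … ξ_{k-1} , ξ_k … ξ_{k+n-2}`: its coordinate at `j` is `ξ_{j+k-1}` for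
`j ≤ n-1` (with `ξ_l = 0` for `l ≤ -1`), and zero for `j > n-1`. -/
noncomputable def chainPoint (n : ℕ) (ξ : Fin (r + 1) → Digit Ds) (k : ℕ) : Vilenkin Ds :=
  ⟨fun j => if j ≤ (n : ℤ) - 1 then ext ξ (j + k - 1) else 0, by
    refine ⟨-(k : ℤ), fun j hj => ?_⟩
    beta_reduce
    split_ifs
    · exact dif_neg (by omega)
    · rfl⟩

/-- The set `Q` of the elements `0 , α_1 … α_{n-1}` for which `α_1 … α_{n-1}` is different from
`ξ_k … ξ_{k+n-2}` for all `k = 1, …, r-n+2`. -/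
def Q (n : ℕ) (ξ : Fin (r + 1) → Digit Ds) : Set (Vilenkin Ds) :=
  {x | (∀ j ≤ 0, x j = 0) ∧ (∀ j > (n : ℤ) - 1, x j = 0) ∧
    ∀ k : ℕ, 1 ≤ k → k + n ≤ r + 2 → word (n - 1) x 1 ≠ word (n - 1) (ext ξ) k}

/-- The explicit expression for the Fourier transform. -/
noncomputable def explicitFourier (ξ : Fin (r + 1) → Digit Ds) (b : (Fin n → Digit Ds) → ℂ)
    (ω : Vilenkin Ds) : ℂ :=
  (∑ k ∈ Finset.Icc 1 (r - n + 2),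
    Set.indicator ({chainPoint n ξ k} + U Ds ((n : ℤ) - 1)) (fun _ => (1 : ℂ)) ω *
      ∏ j ∈ Finset.Icc 1 (k + n - 1), b (word n (ext ξ) ((k : ℤ) - j))) +
  Set.indicator (Q n ξ + U Ds ((n : ℤ) - 1)) (fun _ => (1 : ℂ)) ω *
    ∏ j ∈ Finset.Icc 1 (n - 1),
      b (word n (fun l => if l ≤ 0 then 0 else ω l) (1 - (j : ℤ)))

end Mask

end GenVilenkin

/-!
Let `ω` be a point where the product of the `m_0(𝓜*^{-j} ω)` does not vanish. If the digits
`ω_1 … ω_{n-1}` form a window of `ξ`, then the only nonzero value of `b` available one place to the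
left is the one continuing this window backwards along `ξ`, because distinct windows have at most
one predecessor; repeating this determines all digits of `ω` before the point. Otherwise all of
these digits are zero. Hence the product is locally constant with compact support, has modulus `0`
or `1`, and is given by the explicit formula. Its inverse Fourier transform `φ` is a test function,
and the relation `φ̂(ω) = m_0(𝓜*⁻¹ ω) φ̂(𝓜*⁻¹ ω)` with a Walsh polynomial `m_0` turns into the
refinement equation.

The set where `|φ̂| = 1` arises from `U*` by moving finitely many cosets of `U*_{n-1}` by elements
of `H*`. The characters of the points of `H` are invariant under `H*`, so their integrals against
`|φ̂|²` are the same as over `U*`, which is the orthonormality of the translates of `φ`.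
-/

namespace GenVilenkin

section Pairing

variable {d : ℕ} {M : Matrix (Fin d) (Fin d) ℤ}

theorem isUnit_det_map (hM : M.det ≠ 0) : IsUnit (M.map (fun a : ℤ => (a : ℝ))).det := by
  have hdet : (M.map (fun a : ℤ => (a : ℝ))).det = (M.det : ℝ) :=
    ((Int.castRingHom ℝ).map_det M).symm
  rw [hdet, isUnit_iff_ne_zero]
  exact_mod_cast hM

theorem cast_mulVec (s : Fin d → ℤ) :
    (fun i => ((M.mulVec s i : ℤ) : ℝ))
      = (M.map (fun a : ℤ => (a : ℝ))).mulVec fun i => (s i : ℝ) := by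
  ext i
  simp [Matrix.mulVec, dotProduct]

theorem pairing_comm (x w : Fin d → ℤ) : pairing M x w = pairing M.transpose w x := by
  have hinv : (M.transpose.map (fun a : ℤ => (a : ℝ)))⁻¹
      = ((M.map (fun a : ℤ => (a : ℝ)))⁻¹).transpose := by
    rw [Matrix.transpose_nonsing_inv]
    rfl
  rw [pairing, pairing, hinv, Matrix.mulVec_transpose, dotProduct_comm,
    Matrix.dotProduct_mulVec]

theorem pairing_add_left (x y w : Fin d → ℤ) :
    pairing M (x + y) w = pairing M x w + pairing M y w := by
  have hcast : (fun i => (((x + y) i : ℤ) : ℝ)) = (fun i => (x i : ℝ)) + fun i => (y i : ℝ) := by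
    ext i
    simp
  simp only [pairing, hcast, Matrix.mulVec_add, add_dotProduct]

theorem pairing_mulVec_left (hM : M.det ≠ 0) (s w : Fin d → ℤ) :
    pairing M (M.mulVec s) w = ((s ⬝ᵥ w : ℤ) : ℝ) := by
  rw [pairing, cast_mulVec, Matrix.mulVec_mulVec, Matrix.nonsing_inv_mul _ (isUnit_det_map hM),
    Matrix.one_mulVec]
  simp [dotProduct]

theorem pairing_zero_left (w : Fin d → ℤ) : pairing M 0 w = 0 := by
  simpa using pairing_add_left (M := M) 0 0 w

theorem exists_eq_mulVec_of_pairing (hM : M.det ≠ 0) {x : Fin d → ℤ}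
    (h : ∀ w, ∃ c : ℤ, pairing M x w = c) : ∃ s : Fin d → ℤ, x = M.mulVec s := by
  choose c hc using fun i => h (Pi.single i 1)
  have hcoord : (fun i => (c i : ℝ))
      = (M.map (fun a : ℤ => (a : ℝ)))⁻¹.mulVec fun i => (x i : ℝ) := by
    ext i
    have hsingle : (fun j => (((Pi.single i 1 : Fin d → ℤ) j : ℤ) : ℝ)) = Pi.single i 1 := by
      ext j
      simp [Pi.single_apply]
    rw [← hc i, pairing, hsingle, dotProduct_single, mul_one]
  have hcast := cast_mulVec (M := M) c
  rw [hcoord, Matrix.mulVec_mulVec, Matrix.mul_nonsing_inv _ (isUnit_det_map hM),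
    Matrix.one_mulVec] at hcast
  exact ⟨c, funext fun i => mod_cast (congrFun hcast i).symm⟩

end Pairing

section DigitCharacter

variable {d : ℕ} {M : Matrix (Fin d) (Fin d) ℤ} {D : DigitSet M} {Ds : DigitSet M.transpose}

theorem exists_digit_congruent (D : DigitSet M) (x : Fin d → ℤ) :
    ∃ u : Digit D, Congruent M x u.1 := by
  obtain ⟨u, hu⟩ := (Digit.toQuotient_bijective D).2 (Submodule.Quotient.mk x)
  obtain ⟨s, hs⟩ := (Submodule.Quotient.eq _).1 hu.symm
  exact ⟨u, s, hs.symm⟩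

theorem Digit.eq_zero_of_mulVec {u : Digit D} {s : Fin d → ℤ} (h : u.1 = M.mulVec s) : u = 0 := by
  apply (Digit.toQuotient_bijective D).1
  rw [Digit.toQuotient, Digit.toQuotient, Submodule.Quotient.eq, Digit.zero_val, sub_zero]
  exact ⟨s, h.symm⟩

theorem card_digit (D : DigitSet M) : Nat.card (Digit D) = M.det.natAbs := by
  rw [Nat.card_congr (Digit.equivQuotient D), card_quotient D.det_ne_zero]

theorem exp_two_pi_I_eq_of_sub_eq_int {s t : ℝ} {c : ℤ} (h : s - t = c) :
    Complex.exp (2 * Real.pi * Complex.I * (s : ℂ))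
      = Complex.exp (2 * Real.pi * Complex.I * (t : ℂ)) := by
  rw [Complex.exp_eq_exp_iff_exists_int, sub_eq_iff_eq_add.1 h]
  exact ⟨c, by push_cast; ring⟩

theorem exists_int_of_exp_two_pi_I_eq_one {t : ℝ}
    (h : Complex.exp (2 * Real.pi * Complex.I * (t : ℂ)) = 1) : ∃ c : ℤ, t = c := by
  obtain ⟨c, hc⟩ := Complex.exp_eq_one_iff.1 h
  have htc : (t : ℂ) = c := mul_left_cancel₀ Complex.two_pi_I_ne_zero (by rw [hc]; ring)
  exact ⟨c, mod_cast htc⟩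

/-- The character `exp (2πi⟨M⁻¹ u, v⟩)` pairing the digits of `M` with those of `Mᵀ`; it is the
contribution of a single coordinate to `chi`. -/
noncomputable def digitChar (u : Digit D) (v : Digit Ds) : ℂ :=
  Complex.exp (2 * Real.pi * Complex.I * ((pairing M u.1 v.1 : ℝ) : ℂ))

theorem digitChar_add_left (u u' : Digit D) (v : Digit Ds) :
    digitChar (u + u') v = digitChar u v * digitChar u' v := by
  obtain ⟨s, hs⟩ := Digit.add_congruent u u'
  have hsub : pairing M (u + u').1 v.1 - pairing M (u.1 + u'.1) v.1 = ((s ⬝ᵥ v.1 : ℤ) : ℝ) := by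
    rw [sub_eq_iff_eq_add.1 hs, pairing_add_left, pairing_mulVec_left D.det_ne_zero,
      add_sub_cancel_right]
  rw [digitChar, exp_two_pi_I_eq_of_sub_eq_int hsub, pairing_add_left, digitChar, digitChar,
    ← Complex.exp_add]
  push_cast
  rw [mul_add]

theorem exists_digitChar_ne_one {u : Digit D} (hu : u ≠ 0) :
    ∃ v : Digit Ds, digitChar u v ≠ 1 := by
  by_contra! h
  obtain ⟨s, hs⟩ := exists_eq_mulVec_of_pairing D.det_ne_zero (x := u.1) fun w => by
    obtain ⟨v, s, hs⟩ := exists_digit_congruent Ds w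
    obtain ⟨c, hc⟩ := exists_int_of_exp_two_pi_I_eq_one (h v)
    refine ⟨s ⬝ᵥ u.1 + c, ?_⟩
    rw [sub_eq_iff_eq_add.1 hs, pairing_comm, pairing_add_left,
      pairing_mulVec_left Ds.det_ne_zero, ← pairing_comm, hc, Int.cast_add]
  exact hu (Digit.eq_zero_of_mulVec hs)

end DigitCharacter

section Cosets

variable {d : ℕ} {M : Matrix (Fin d) (Fin d) ℤ} {D : DigitSet M}

@[simp]
theorem coe_add (x y : Vilenkin D) (j : ℤ) : (x + y) j = x j + y j := rfl

@[simp]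
theorem coe_sub (x y : Vilenkin D) (j : ℤ) : (x - y) j = x j - y j := rfl

@[simp]
theorem dil_apply (k : ℤ) (x : Vilenkin D) (j : ℤ) : (dil k x) j = x (j + k) := rfl

theorem vilenkin_ext {x y : Vilenkin D} (h : ∀ j, x j = y j) : x = y :=
  Subtype.ext (funext h)

theorem mem_U {l : ℤ} {x : Vilenkin D} : x ∈ U D l ↔ ∀ j ≤ l, x j = 0 := Iff.rfl

theorem U_antitone : Antitone (U D) := fun _ _ h _ hx j hj => hx j (hj.trans h)

theorem exists_mem_U (x : Vilenkin D) : ∃ l : ℤ, x ∈ U D l := by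
  obtain ⟨N, hN⟩ := x.2
  exact ⟨N - 1, fun j hj => hN j (by omega)⟩

theorem iUnion_U (D : DigitSet M) : ⋃ N : ℕ, U D (-(N : ℤ)) = Set.univ := by
  refine Set.eq_univ_of_forall fun x => ?_
  obtain ⟨l, hl⟩ := exists_mem_U x
  exact Set.mem_iUnion.2 ⟨(-l).toNat, U_antitone (by omega) hl⟩

/-- The element with coordinate `a` at the place `i` and zero coordinates elsewhere. -/
noncomputable def single (D : DigitSet M) (i : ℤ) (a : Digit D) : Vilenkin D :=
  ⟨fun j => if j = i then a else 0, i, fun _ hj => if_neg hj.ne⟩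

@[simp]
theorem single_apply_self (i : ℤ) (a : Digit D) : (single D i a) i = a := if_pos rfl

theorem single_apply_of_ne {i j : ℤ} (h : j ≠ i) (a : Digit D) : (single D i a) j = 0 := if_neg h

theorem single_mem_U {i l : ℤ} (h : l < i) (a : Digit D) : single D i a ∈ U D l :=
  fun _ hj => single_apply_of_ne (by omega) a

/-- The truncation of `x` to the coordinates with indices `≤ l`. -/
noncomputable def trunc (l : ℤ) (x : Vilenkin D) : Vilenkin D :=
  ⟨fun j => if j ≤ l then x j else 0, by
    obtain ⟨N, hN⟩ := x.2
    exact ⟨N, fun j hj => by simp [hN j hj]⟩⟩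

theorem trunc_apply (l : ℤ) (x : Vilenkin D) (j : ℤ) :
    (trunc l x) j = if j ≤ l then x j else 0 := rfl

theorem finite_support_trunc (l : ℤ) (x : Vilenkin D) :
    (Function.support fun j => (trunc l x) j).Finite := by
  obtain ⟨N, hN⟩ := x.2
  refine (Set.finite_Icc N l).subset fun j hj => ?_
  rw [Function.mem_support, trunc_apply, ne_eq, ite_eq_right_iff, Classical.not_imp] at hj
  exact ⟨not_lt.1 fun h => hj.2 (hN j h), hj.1⟩

/-- The coset of `U_l` containing `x`. -/
def coset (x : Vilenkin D) (l : ℤ) : Set (Vilenkin D) := {y | y - x ∈ U D l}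

theorem mem_coset_iff {x y : Vilenkin D} {l : ℤ} : y ∈ coset x l ↔ ∀ j ≤ l, y j = x j := by
  simp only [coset, Set.mem_ofPred_eq, mem_U, coe_sub, sub_eq_zero]

theorem self_mem_coset (x : Vilenkin D) (l : ℤ) : x ∈ coset x l := mem_coset_iff.2 fun _ _ => rfl

theorem add_mem_coset (x : Vilenkin D) {l : ℤ} {u : Vilenkin D} (hu : u ∈ U D l) :
    x + u ∈ coset x l := by
  rwa [coset, Set.mem_ofPred_eq, add_sub_cancel_left]

theorem coset_zero (l : ℤ) : coset (0 : Vilenkin D) l = U D l := by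
  simp only [coset, sub_zero, Set.ofPred_mem_eq]

theorem singleton_add_U (x : Vilenkin D) (l : ℤ) : {x} + U D l = coset x l := by
  ext y
  rw [Set.singleton_add, Set.mem_image]
  constructor
  · rintro ⟨u, hu, rfl⟩
    exact add_mem_coset x hu
  · exact fun hy => ⟨y - x, hy, add_sub_cancel x y⟩

theorem coset_subset_coset {x y z : Vilenkin D} {l k : ℤ} (hlk : l ≤ k) (hx : z ∈ coset x l)
    (hy : z ∈ coset y k) : coset y k ⊆ coset x l := fun _ hw =>
  mem_coset_iff.2 fun j hj =>
    ((mem_coset_iff.1 hw j (hj.trans hlk)).trans (mem_coset_iff.1 hy j (hj.trans hlk)).symm).trans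
      (mem_coset_iff.1 hx j hj)

theorem coset_trunc (x : Vilenkin D) (l : ℤ) : coset (trunc l x) l = coset x l := by
  ext y
  simp +contextual only [mem_coset_iff, trunc_apply, if_true]

theorem U_eq_iUnion_coset (l : ℤ) :
    U D l = ⋃ a : Digit D, coset (single D (l + 1) a) (l + 1) := by
  ext x
  simp only [Set.mem_iUnion, mem_coset_iff]
  constructor
  · intro hx
    refine ⟨x (l + 1), fun j hj => ?_⟩
    rcases hj.eq_or_lt with rfl | hj
    · rw [single_apply_self]
    · rw [hx j (by omega), single_apply_of_ne hj.ne]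
  · rintro ⟨a, ha⟩ j hj
    rw [ha j (by omega), single_apply_of_ne (by omega)]

theorem pairwise_disjoint_coset_single (l : ℤ) :
    Pairwise (Function.onFun Disjoint fun a : Digit D => coset (single D l a) l) := by
  intro a b hab
  rw [Function.onFun, Set.disjoint_left]
  intro y ha hb
  have hya := mem_coset_iff.1 ha l le_rfl
  have hyb := mem_coset_iff.1 hb l le_rfl
  rw [single_apply_self] at hya hyb
  exact hab (hya.symm.trans hyb)

end Cosets

section Dilation

variable {d : ℕ} {M : Matrix (Fin d) (Fin d) ℤ} {D : DigitSet M}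

/-- The shift `𝓜^k` as an additive equivalence. -/
def dilEquiv (D : DigitSet M) (k : ℤ) : Vilenkin D ≃+ Vilenkin D where
  toFun := dil k
  invFun := dil (-k)
  left_inv x := vilenkin_ext fun j => by simp
  right_inv x := vilenkin_ext fun j => by simp
  map_add' _ _ := rfl

theorem dil_mem_U {k l : ℤ} {x : Vilenkin D} : dil k x ∈ U D l ↔ x ∈ U D (l + k) :=
  ⟨fun h j hj => by simpa using h (j - k) (by omega), fun h j hj => h (j + k) (by omega)⟩

theorem image_dil_U (k l : ℤ) : dil k '' U D l = U D (l - k) := by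
  ext x
  constructor
  · rintro ⟨y, hy, rfl⟩
    rwa [dil_mem_U, sub_add_cancel]
  · intro hx
    exact ⟨dil (-k) x, dil_mem_U.2 (by rwa [← sub_eq_add_neg]), (dilEquiv D k).right_inv x⟩

theorem continuous_dil (k : ℤ) : Continuous (dil k : Vilenkin D → Vilenkin D) := by
  rw [continuous_def]
  intro S hS x hx
  obtain ⟨l, hl⟩ := isOpen_iff.1 hS _ hx
  exact ⟨l + k, fun u hu => hl (dil k u) (dil_mem_U.2 hu)⟩

end Dilation

section Topology

variable {d : ℕ} {M : Matrix (Fin d) (Fin d) ℤ} {D : DigitSet M}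

theorem isCompact_U (l : ℤ) : IsCompact (U D l) := by
  simpa only [image_dil_U, zero_sub, neg_neg] using (isCompact_U_zero D).image (continuous_dil (-l))

theorem continuous_of_locally_invariant {X : Type*} [TopologicalSpace X] {f : Vilenkin D → X}
    (h : ∀ x, ∃ l : ℤ, ∀ u ∈ U D l, f (x + u) = f x) : Continuous f := by
  rw [continuous_def]
  intro S _ x hx
  obtain ⟨l, hl⟩ := h x
  exact ⟨l, fun u hu => by rwa [Set.mem_preimage, hl u hu]⟩

instance : LocallyCompactSpace (Vilenkin D) :=
  (isCompact_U_zero D).locallyCompactSpace_of_mem_nhds_of_addGroup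
    ((isOpen_U D 0).mem_nhds (zero_mem_U D 0))

instance : T2Space (Vilenkin D) := by
  refine IsTopologicalAddGroup.t2Space_of_zero_sep fun x hx => ?_
  by_contra! h
  exact hx (vilenkin_ext fun j => h (U D j) ((isOpen_U D j).mem_nhds (zero_mem_U D j)) j le_rfl)

/-- The family of all cosets of all subgroups `U_l`, a countable base of the topology of `V` that
is also a `π`-system. -/
def cosets (D : DigitSet M) : Set (Set (Vilenkin D)) :=
  Set.range fun p : Vilenkin D × ℤ => coset p.1 p.2

theorem coset_mem_cosets (x : Vilenkin D) (l : ℤ) : coset x l ∈ cosets D := ⟨(x, l), rfl⟩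

theorem isTopologicalBasis_cosets : TopologicalSpace.IsTopologicalBasis (cosets D) := by
  refine TopologicalSpace.isTopologicalBasis_of_isOpen_of_nhds ?_ fun x S hx hS => ?_
  · rintro _ ⟨⟨x, l⟩, rfl⟩
    exact isOpen_coset x l
  · obtain ⟨l, hl⟩ := isOpen_iff.1 hS x hx
    refine ⟨_, coset_mem_cosets x l, self_mem_coset x l, fun y hy => ?_⟩
    simpa using hl _ hy

theorem countable_cosets : (cosets D).Countable := by
  have hcentres : Set.Countable {c : Vilenkin D | (Function.support fun j => c j).Finite} := by
    refine Set.MapsTo.countable_of_injOn (t := Set.range fun p : ℤ →₀ Digit D => (p : ℤ → Digit D))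
      (f := fun x : Vilenkin D => fun j => x j) (fun x hx => ?_) (fun x _ y _ h => ?_)
      (Set.countable_range _)
    · exact ⟨Finsupp.ofSupportFinite _ hx, rfl⟩
    · exact Subtype.ext h
  refine ((hcentres.prod Set.countable_univ).image fun p : Vilenkin D × ℤ => coset p.1 p.2).mono ?_
  rintro _ ⟨⟨x, l⟩, rfl⟩
  exact ⟨⟨trunc l x, l⟩, ⟨finite_support_trunc l x, trivial⟩, coset_trunc x l⟩

instance : SecondCountableTopology (Vilenkin D) :=
  isTopologicalBasis_cosets.secondCountableTopology countable_cosets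

theorem isPiSystem_cosets : IsPiSystem (cosets D) := by
  rintro _ ⟨⟨x, l⟩, rfl⟩ _ ⟨⟨y, k⟩, rfl⟩ ⟨z, hx, hy⟩
  rcases le_total l k with h | h
  · rw [Set.inter_eq_right.2 (coset_subset_coset h hx hy)]
    exact coset_mem_cosets y k
  · rw [Set.inter_eq_left.2 (coset_subset_coset h hy hx)]
    exact coset_mem_cosets x l

theorem measurableSpace_eq_generateFrom_cosets :
    (inferInstance : MeasurableSpace (Vilenkin D)) = MeasurableSpace.generateFrom (cosets D) :=
  isTopologicalBasis_cosets.borel_eq_generateFrom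

end Topology

section Haar

variable {d : ℕ} {M : Matrix (Fin d) (Fin d) ℤ} {D : DigitSet M}

theorem measurableSet_U (l : ℤ) : MeasurableSet (U D l) := (isOpen_U D l).measurableSet

theorem measurableSet_coset (x : Vilenkin D) (l : ℤ) : MeasurableSet (coset x l) :=
  (isOpen_coset x l).measurableSet

theorem haar_U_ne_top (l : ℤ) : haar D (U D l) ≠ ∞ := (isCompact_U l).measure_lt_top.ne

theorem haar_coset (x : Vilenkin D) (l : ℤ) : haar D (coset x l) = haar D (U D l) := by
  have hpre : coset x l = (fun y => y + -x) ⁻¹' U D l := by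
    ext y
    simp only [coset, sub_eq_add_neg, Set.mem_ofPred_eq, Set.mem_preimage]
  rw [hpre, measure_preimage_add_right]

theorem haar_real_U_succ (l : ℤ) :
    (haar D).real (U D l) = M.det.natAbs * (haar D).real (U D (l + 1)) := by
  have : Fintype (Digit D) := Fintype.ofFinite _
  rw [U_eq_iUnion_coset, measureReal_iUnion_fintype (pairwise_disjoint_coset_single (l + 1))
    (fun a => measurableSet_coset _ _) (fun a => by rw [haar_coset]; exact haar_U_ne_top _)]
  simp only [Measure.real, haar_coset, Finset.sum_const, nsmul_eq_mul, Finset.card_univ,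
    ← Nat.card_eq_fintype_card, card_digit]

theorem haar_real_U (l : ℤ) : (haar D).real (U D l) = (M.det.natAbs : ℝ) ^ (-l) := by
  have hm : (M.det.natAbs : ℝ) ≠ 0 := Nat.cast_ne_zero.2 D.m_pos.ne'
  induction l using Int.induction_on with
  | zero => rw [Measure.real, haar_U, neg_zero, zpow_zero, ENNReal.toReal_one]
  | succ l ih =>
    rw [haar_real_U_succ, mul_comm, ← eq_div_iff hm] at ih
    rw [ih, neg_add, zpow_add₀ hm, zpow_neg_one, div_eq_mul_inv]
  | pred l ih =>
    rw [haar_real_U_succ, sub_add_cancel, ih, neg_sub, sub_eq_add_neg, zpow_add₀ hm, zpow_one]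

theorem haar_real_U_neg_mul_haar_real_U (D : DigitSet M) (Ds : DigitSet M.transpose) (l : ℤ) :
    (haar D).real (U D (-l)) * (haar Ds).real (U Ds l) = 1 := by
  have hm : (M.det.natAbs : ℝ) ≠ 0 := Nat.cast_ne_zero.2 D.m_pos.ne'
  rw [haar_real_U, haar_real_U, Matrix.det_transpose, ← zpow_add₀ hm, neg_neg, add_neg_cancel,
    zpow_zero]

theorem setIntegral_inter_U_eq_zero {f : Vilenkin D → ℂ}
    (hf : ∀ l, IntegrableOn f (U D l) (haar D))
    (h : ∀ x l, ∫ y in coset x l, f y ∂(haar D) = 0) (l : ℤ) {s : Set (Vilenkin D)}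
    (hs : MeasurableSet s) : ∫ y in s ∩ U D l, f y ∂(haar D) = 0 := by
  induction s, hs using MeasurableSpace.induction_on_inter
    measurableSpace_eq_generateFrom_cosets isPiSystem_cosets with
  | empty => rw [Set.empty_inter, setIntegral_empty]
  | basic t ht =>
    rcases (t ∩ U D l).eq_empty_or_nonempty with hempty | hne
    · rw [hempty, setIntegral_empty]
    · obtain ⟨⟨z, i⟩, hz⟩ :=
        isPiSystem_cosets t ht (U D l) (coset_zero (D := D) l ▸ coset_mem_cosets 0 l) hne
      rw [← hz]
      exact h z i
  | compl t ht ih =>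
    have hsplit := integral_inter_add_sdiff (s := U D l) ht (hf l)
    rwa [Set.inter_comm, ih, zero_add, ← coset_zero, h 0 l, coset_zero, Set.sdiff_eq,
      Set.inter_comm] at hsplit
  | iUnion g hd hm ih =>
    rw [Set.iUnion_inter, integral_iUnion (fun i => (hm i).inter (measurableSet_U l))
      (fun i j hij => (hd hij).mono Set.inter_subset_left Set.inter_subset_left)
      ((hf l).mono_set (Set.iUnion_subset fun i => Set.inter_subset_right))]
    simp only [ih, tsum_zero]

theorem ae_eq_zero_of_setIntegral_coset_eq_zero {f : Vilenkin D → ℂ}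
    (hf : ∀ l, IntegrableOn f (U D l) (haar D))
    (h : ∀ x l, ∫ y in coset x l, f y ∂(haar D) = 0) : f =ᵐ[haar D] 0 := by
  rw [← Measure.restrict_univ (μ := haar D), ← iUnion_U, Filter.EventuallyEq,
    ae_restrict_iUnion_iff]
  intro N
  refine Integrable.ae_eq_zero_of_forall_setIntegral_eq_zero (hf _) fun s hs _ => ?_
  rw [Measure.restrict_restrict hs]
  exact setIntegral_inter_U_eq_zero hf h _ hs

end Haar

section Character

variable {d : ℕ} {M : Matrix (Fin d) (Fin d) ℤ} {D : DigitSet M} {Ds : DigitSet M.transpose}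

theorem chi_eq_prod (x : Vilenkin D) (ω : Vilenkin Ds) {S : Finset ℤ}
    (h : ∀ j ∉ S, x j = 0 ∨ ω (1 - j) = 0) :
    chi x ω = ∏ j ∈ S, digitChar (x j) (ω (1 - j)) := by
  have hsupp : Function.support (fun j : ℤ => pairing M (x j).1 (ω (1 - j)).1) ⊆ S := by
    intro j hj
    by_contra hjS
    rcases h j hjS with h | h
    · exact hj (by simp only [h, Digit.zero_val, pairing_zero_left])
    · exact hj (by simp only [h, Digit.zero_val, pairing_comm _ (0 : Fin d → ℤ), pairing_zero_left])
  rw [chi, finsum_eq_sum_of_support_subset _ hsupp]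
  simp only [digitChar, ← Complex.exp_sum, Complex.ofReal_sum, Finset.mul_sum]

theorem exists_finset_forall_notMem (x : Vilenkin D) (ω : Vilenkin Ds) :
    ∃ S : Finset ℤ, ∀ j ∉ S, x j = 0 ∨ ω (1 - j) = 0 := by
  obtain ⟨l, hl⟩ := exists_mem_U x
  obtain ⟨k, hk⟩ := exists_mem_U ω
  refine ⟨Finset.Icc (l + 1) (-k), fun j hj => ?_⟩
  rw [Finset.mem_Icc, not_and_or] at hj
  rcases hj with h | h
  · exact Or.inl (hl j (by omega))
  · exact Or.inr (hk _ (by omega))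

-- On the right `D` is read as a digit set of `Mᵀᵀ`, which is `M` by definition.
theorem chi_comm (x : Vilenkin D) (ω : Vilenkin Ds) :
    chi x ω = chi (D := Ds) (Ds := D) ω x := by
  have hsum : ∑ᶠ j : ℤ, pairing M (x j).1 (ω (1 - j)).1
      = ∑ᶠ j : ℤ, pairing M.transpose (ω j).1 (x (1 - j)).1 := by
    refine finsum_eq_of_bijective (fun j => 1 - j) (Equiv.subLeft 1).bijective fun j => ?_
    rw [pairing_comm, sub_sub_cancel]
  exact congrArg (fun t : ℝ => Complex.exp (2 * Real.pi * Complex.I * (t : ℂ))) hsum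

theorem chi_add_left (x y : Vilenkin D) (ω : Vilenkin Ds) :
    chi (x + y) ω = chi x ω * chi y ω := by
  obtain ⟨S, hS⟩ := exists_finset_forall_notMem x ω
  obtain ⟨T, hT⟩ := exists_finset_forall_notMem y ω
  have hx : ∀ j ∉ S ∪ T, x j = 0 ∨ ω (1 - j) = 0 := fun j hj =>
    hS j fun h => hj (Finset.mem_union_left _ h)
  have hy : ∀ j ∉ S ∪ T, y j = 0 ∨ ω (1 - j) = 0 := fun j hj =>
    hT j fun h => hj (Finset.mem_union_right _ h)
  have hxy : ∀ j ∉ S ∪ T, (x + y) j = 0 ∨ ω (1 - j) = 0 := fun j hj => by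
    rcases hx j hj, hy j hj with ⟨h | h, h' | h'⟩
    · exact Or.inl (by rw [coe_add, h, h', add_zero])
    all_goals exact Or.inr ‹_›
  rw [chi_eq_prod x ω hx, chi_eq_prod y ω hy, chi_eq_prod (x + y) ω hxy,
    ← Finset.prod_mul_distrib]
  exact Finset.prod_congr rfl fun j _ => digitChar_add_left _ _ _

theorem chi_add_right (x : Vilenkin D) (ω ν : Vilenkin Ds) :
    chi x (ω + ν) = chi x ω * chi x ν := by
  rw [chi_comm, chi_comm, chi_comm]
  exact chi_add_left ω ν x

theorem chi_eq_one {x : Vilenkin D} {ω : Vilenkin Ds}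
    (h : ∀ j, x j = 0 ∨ ω (1 - j) = 0) : chi x ω = 1 := by
  rw [chi_eq_prod x ω (S := ∅) fun j _ => h j, Finset.prod_empty]

theorem chi_eq_one_of_mem_U {x : Vilenkin D} {ω : Vilenkin Ds} {l k : ℤ} (hx : x ∈ U D l)
    (hω : ω ∈ U Ds k) (h : 0 ≤ l + k) : chi x ω = 1 :=
  chi_eq_one fun j => (le_or_gt j l).imp (hx j) fun _ => hω _ (by omega)

theorem chi_eq_one_of_mem_H {x : Vilenkin D} {ω : Vilenkin Ds} (hx : x ∈ H D)
    (hω : ω ∈ H Ds) : chi x ω = 1 :=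
  chi_eq_one fun j => (lt_or_ge 0 j).imp (hx j) fun _ => hω _ (by omega)

@[simp]
theorem chi_zero_left (ω : Vilenkin Ds) : chi (0 : Vilenkin D) ω = 1 :=
  chi_eq_one fun _ => Or.inl rfl

@[simp]
theorem chi_zero_right (x : Vilenkin D) : chi x (0 : Vilenkin Ds) = 1 :=
  chi_eq_one fun _ => Or.inr rfl

@[simp]
theorem norm_chi (x : Vilenkin D) (ω : Vilenkin Ds) : ‖chi x ω‖ = 1 := by
  rw [chi, mul_right_comm, ← Complex.ofReal_ofNat, ← Complex.ofReal_mul, ← Complex.ofReal_mul,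
    Complex.norm_exp_ofReal_mul_I]

theorem chi_ne_zero (x : Vilenkin D) (ω : Vilenkin Ds) : chi x ω ≠ 0 := Complex.exp_ne_zero _

theorem conj_chi_mul_self (x : Vilenkin D) (ω : Vilenkin Ds) : conj (chi x ω) * chi x ω = 1 := by
  rw [Complex.conj_mul', norm_chi, Complex.ofReal_one, one_pow]

theorem chi_neg_left (x : Vilenkin D) (ω : Vilenkin Ds) : chi (-x) ω = conj (chi x ω) := by
  apply mul_right_cancel₀ (chi_ne_zero x ω)
  rw [← chi_add_left, neg_add_cancel, chi_zero_left, conj_chi_mul_self]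

theorem chi_neg_right (x : Vilenkin D) (ω : Vilenkin Ds) : chi x (-ω) = conj (chi x ω) := by
  apply mul_right_cancel₀ (chi_ne_zero x ω)
  rw [← chi_add_right, neg_add_cancel, chi_zero_right, conj_chi_mul_self]

theorem chi_sub_left (x y : Vilenkin D) (ω : Vilenkin Ds) :
    chi (x - y) ω = chi x ω * conj (chi y ω) := by
  rw [sub_eq_add_neg, chi_add_left, chi_neg_left]

theorem chi_sub_right (x : Vilenkin D) (ω ν : Vilenkin Ds) :
    chi x (ω - ν) = chi x ω * conj (chi x ν) := by
  rw [sub_eq_add_neg, chi_add_right, chi_neg_right]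

theorem chi_dil (k : ℤ) (x : Vilenkin D) (ω : Vilenkin Ds) :
    chi (dil k x) (dil (-k) ω) = chi x ω := by
  rw [chi, chi]
  congr 3
  refine finsum_eq_of_bijective (fun j => j + k) (Equiv.addRight k).bijective fun j => ?_
  simp only [dil_apply, show 1 - j + -k = 1 - (j + k) by ring]

theorem chi_single_right (i : ℤ) (x : Vilenkin D) (a : Digit Ds) :
    chi x (single Ds i a) = digitChar (x (1 - i)) a := by
  rw [chi_eq_prod x _ (S := {1 - i}), Finset.prod_singleton, sub_sub_cancel, single_apply_self]
  intro j hj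
  refine Or.inr (single_apply_of_ne (fun h => hj ?_) a)
  rw [Finset.mem_singleton]
  omega

theorem exists_chi_ne_one_right {x : Vilenkin D} {l : ℤ} (h : x ∉ U D (-l)) :
    ∃ ν ∈ U Ds l, chi x ν ≠ 1 := by
  simp only [mem_U, not_forall] at h
  obtain ⟨i, hi, hne⟩ := h
  obtain ⟨a, ha⟩ := exists_digitChar_ne_one (Ds := Ds) hne
  refine ⟨single Ds (1 - i) a, single_mem_U (by omega) a, ?_⟩
  rwa [chi_single_right, sub_sub_cancel]

theorem continuous_chi_right (x : Vilenkin D) : Continuous fun ω : Vilenkin Ds => chi x ω := by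
  obtain ⟨k, hk⟩ := exists_mem_U x
  refine continuous_of_locally_invariant fun ω => ⟨-k, fun u hu => ?_⟩
  rw [chi_add_right, chi_eq_one_of_mem_U hk hu (by omega), mul_one]

theorem continuous_chi_left (ω : Vilenkin Ds) : Continuous fun x : Vilenkin D => chi x ω := by
  simp only [chi_comm _ ω]
  exact continuous_chi_right ω

theorem continuous_chi : Continuous fun p : Vilenkin D × Vilenkin Ds => chi p.1 p.2 := by
  rw [continuous_iff_continuousAt]
  rintro ⟨x, ω⟩
  obtain ⟨l, hl⟩ := exists_mem_U x
  obtain ⟨k, hk⟩ := exists_mem_U ω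
  have hx : coset x (max 0 (-k)) ∈ 𝓝 x := (isOpen_coset x _).mem_nhds (self_mem_coset x _)
  have hω : coset ω (max 0 (-l)) ∈ 𝓝 ω := (isOpen_coset ω _).mem_nhds (self_mem_coset ω _)
  refine ContinuousAt.congr (f := fun _ => chi x ω) continuousAt_const ?_
  filter_upwards [prod_mem_nhds hx hω]
  rintro ⟨y, ν⟩ ⟨hy, hν⟩
  calc chi x ω
      = chi (x + (y - x)) (ω + (ν - ω)) := by
        rw [chi_add_left, chi_add_right, chi_add_right, chi_eq_one_of_mem_U hl hν (by omega),
          chi_eq_one_of_mem_U hy hk (by omega), chi_eq_one_of_mem_U hy hν (by omega), mul_one,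
          mul_one, mul_one]
    _ = chi y ν := by rw [add_sub_cancel, add_sub_cancel]

theorem setIntegral_U_eq_zero_of_apply_add {f : Vilenkin D → ℂ} {l : ℤ} {u : Vilenkin D} {c : ℂ}
    (hu : u ∈ U D l) (hc : c ≠ 1) (hf : ∀ x, f (x + u) = c * f x) :
    ∫ x in U D l, f x ∂(haar D) = 0 := by
  have htranslate : ∀ x, (U D l).indicator f (x + u) = c * (U D l).indicator f x := by
    intro x
    by_cases hx : x ∈ U D l
    · rw [Set.indicator_of_mem hx, Set.indicator_of_mem (add_mem_U hx hu), hf]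
    · rw [Set.indicator_of_notMem hx, Set.indicator_of_notMem, mul_zero]
      exact fun h => hx (by simpa using add_mem_U h (neg_mem_U hu))
  have hinvariant := integral_add_right_eq_self (μ := haar D) ((U D l).indicator f) u
  simp only [htranslate, integral_const_mul, integral_indicator (measurableSet_U l)] at hinvariant
  by_contra h0
  exact hc ((mul_eq_right₀ h0).1 hinvariant)

theorem setIntegral_chi_right (l : ℤ) (x : Vilenkin D) :
    ∫ ω in U Ds l, chi x ω ∂(haar Ds)
      = (U D (-l)).indicator (fun _ => ((haar Ds).real (U Ds l) : ℂ)) x := by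
  by_cases h : x ∈ U D (-l)
  · have hone : Set.EqOn (chi x) (fun _ : Vilenkin Ds => (1 : ℂ)) (U Ds l) := fun ω hω =>
      chi_eq_one_of_mem_U h hω (by omega)
    rw [Set.indicator_of_mem h, setIntegral_congr_fun (measurableSet_U l) hone, setIntegral_const,
      Complex.real_smul, mul_one]
  · rw [Set.indicator_of_notMem h]
    obtain ⟨u, hu, hne⟩ := exists_chi_ne_one_right (Ds := Ds) h
    exact setIntegral_U_eq_zero_of_apply_add hu hne fun ω => by rw [chi_add_right, mul_comm]

theorem setIntegral_chi_left (l : ℤ) (ω : Vilenkin Ds) :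
    ∫ x in U D l, chi x ω ∂(haar D)
      = (U Ds (-l)).indicator (fun _ => ((haar D).real (U D l) : ℂ)) ω := by
  simp only [chi_comm _ ω]
  exact setIntegral_chi_right l ω

end Character

section TestFunctions

variable {d : ℕ} {M : Matrix (Fin d) (Fin d) ℤ} {D : DigitSet M} {f : Vilenkin D → ℂ} {l k : ℤ}

/-- `f` is invariant under `U_l` and vanishes outside `U_{-k}`. This describes the class
`𝓢_l^{(k)}` without reference to the elements `γ_[i]`, so that the two parameters become exchanged
under the Fourier transform. -/
structure IsTestFun (l k : ℤ) (f : Vilenkin D → ℂ) : Prop where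
  apply_add : ∀ x, ∀ u ∈ U D l, f (x + u) = f x
  support_subset : Function.support f ⊆ U D (-k)

theorem IsTestFun.apply_eq_zero (hf : IsTestFun l k f) {x : Vilenkin D} (hx : x ∉ U D (-k)) :
    f x = 0 :=
  Function.notMem_support.1 fun h => hx (hf.support_subset h)

theorem IsTestFun.apply_eq_of_mem_coset (hf : IsTestFun l k f) {x y : Vilenkin D}
    (h : y ∈ coset x l) : f y = f x := by
  rw [← hf.apply_add x _ h, add_sub_cancel]

theorem IsTestFun.continuous (hf : IsTestFun l k f) : Continuous f :=
  continuous_of_locally_invariant fun x => ⟨l, hf.apply_add x⟩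

theorem IsTestFun.hasCompactSupport (hf : IsTestFun l k f) : HasCompactSupport f :=
  HasCompactSupport.of_support_subset_isCompact (isCompact_U _) hf.support_subset

theorem IsTestFun.integrable (hf : IsTestFun l k f) : Integrable f (haar D) :=
  hf.continuous.integrable_of_hasCompactSupport hf.hasCompactSupport

theorem IsTestFun.memLp (hf : IsTestFun l k f) (p : ℝ≥0∞) : MemLp f p (haar D) :=
  hf.continuous.memLp_of_hasCompactSupport hf.hasCompactSupport

theorem IsTestFun.mem_testFun (hf : IsTestFun l k f) : f ∈ TestFun D l k := by
  refine ⟨fun i x hx x' hx' => ?_, by rw [image_dil_U, zero_sub]; exact hf.support_subset⟩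
  rw [Unk, image_dil_U, zero_sub, neg_neg, singleton_add_U] at hx hx'
  rw [hf.apply_eq_of_mem_coset hx, hf.apply_eq_of_mem_coset hx']

end TestFunctions

section Kernel

variable {α β : Type*} [MeasurableSpace α] [MeasurableSpace β] {μ : Measure α} {ν : Measure β}

theorem integral_mul_integral_kernel_comm [SFinite μ] [SFinite ν] {F : α → ℂ} {G : β → ℂ}
    {K : α → β → ℂ} {C : ℝ} (hF : Integrable F μ) (hG : Integrable G ν)
    (hK : AEStronglyMeasurable (Function.uncurry K) (μ.prod ν)) (hC : ∀ x y, ‖K x y‖ ≤ C) :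
    ∫ x, F x * ∫ y, G y * K x y ∂ν ∂μ = ∫ y, G y * ∫ x, F x * K x y ∂μ ∂ν := by
  have hint : Integrable (fun p : α × β => F p.1 * (G p.2 * K p.1 p.2)) (μ.prod ν) := by
    simp only [← mul_assoc]
    exact (hF.mul_prod hG).mul_bdd hK (Eventually.of_forall fun p => hC p.1 p.2)
  simp only [← integral_const_mul]
  rw [integral_integral_swap hint]
  simp only [mul_left_comm]

theorem tendsto_integral_mul_of_tendsto_eLpNorm [IsFiniteMeasure μ] {ι : Type*} {L : Filter ι}
    {e g : α → ℂ} {G : ι → α → ℂ} {C : ℝ} (he : AEStronglyMeasurable e μ) (hC : ∀ x, ‖e x‖ ≤ C)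
    (hg : Integrable g μ) (hG : ∀ i, Integrable (G i) μ)
    (hlim : Tendsto (fun i => eLpNorm (fun x => G i x - g x) 2 μ) L (𝓝 0)) :
    Tendsto (fun i => ∫ x, e x * G i x ∂μ) L (𝓝 (∫ x, e x * g x ∂μ)) := by
  have hbdd : ∀ᵐ x ∂μ, ‖e x‖ ≤ C := Eventually.of_forall hC
  refine tendsto_integral_of_L1' _ (hg.bdd_mul he hbdd).aestronglyMeasurable
    (Eventually.of_forall fun i => (hG i).bdd_mul he hbdd) ?_
  have hle : ∀ i, eLpNorm ((fun x => e x * G i x) - fun x => e x * g x) 1 μ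
      ≤ ENNReal.ofReal C * (eLpNorm (fun x => G i x - g x) 2 μ *
        μ Set.univ ^ (1 / (1 : ℝ≥0∞).toReal - 1 / (2 : ℝ≥0∞).toReal)) := by
    intro i
    refine (eLpNorm_le_mul_eLpNorm_of_ae_le_mul (g := fun x => G i x - g x) (c := C)
      (hbdd.mono fun x hx => ?_) 1).trans ?_
    · rw [Pi.sub_apply, ← mul_sub, norm_mul]
      gcongr
    · gcongr
      exact eLpNorm_le_eLpNorm_mul_rpow_measure_univ one_le_two
        ((hG i).sub hg).aestronglyMeasurable
  refine tendsto_of_tendsto_of_tendsto_of_le_of_le tendsto_const_nhds ?_ (fun _ => zero_le) hle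
  have hfinite : μ Set.univ ^ (1 / (1 : ℝ≥0∞).toReal - 1 / (2 : ℝ≥0∞).toReal) ≠ ∞ :=
    ENNReal.rpow_ne_top_of_nonneg (by norm_num) (measure_ne_top _ _)
  simpa only [zero_mul, mul_zero] using ENNReal.Tendsto.const_mul
    (ENNReal.Tendsto.mul_const hlim (Or.inr hfinite)) (Or.inr ENNReal.ofReal_ne_top)

end Kernel

section Fourier

variable {d : ℕ} {M : Matrix (Fin d) (Fin d) ℤ} {D : DigitSet M} {Ds : DigitSet M.transpose}

theorem continuous_fourier {f : Vilenkin D → ℂ} (hf : Integrable f (haar D)) :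
    Continuous (fourier Ds f) := by
  refine continuous_of_dominated (F := fun ω x => f x * conj (chi x ω)) (bound := fun x => ‖f x‖)
    (fun ω => ?_) (fun ω => Eventually.of_forall fun x => ?_) hf.norm
    (Eventually.of_forall fun x => ?_)
  · exact hf.aestronglyMeasurable.mul
      (Complex.continuous_conj.comp (continuous_chi_left ω)).aestronglyMeasurable
  · rw [norm_mul, RCLike.norm_conj, norm_chi, mul_one]
  · exact continuous_const.mul (Complex.continuous_conj.comp (continuous_chi_right x))

theorem fourier_congr_ae {f f' : Vilenkin D → ℂ} (h : f =ᵐ[haar D] f') :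
    fourier Ds f = fourier Ds f' :=
  funext fun _ => integral_congr_ae (h.mono fun x hx => by simp only [hx])

theorem setIntegral_conj_chi_mul_chi_right (l : ℤ) (x y : Vilenkin D) :
    ∫ ω in U Ds l, conj (chi x ω) * chi y ω ∂(haar Ds)
      = (coset x (-l)).indicator (fun _ => ((haar Ds).real (U Ds l) : ℂ)) y := by
  simp only [mul_comm (conj _), ← chi_sub_left]
  exact setIntegral_chi_right l (y - x)

theorem setIntegral_conj_chi_mul_chi_left (l : ℤ) (ω ν : Vilenkin Ds) :
    ∫ x in U D l, conj (chi x ω) * chi x ν ∂(haar D)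
      = (coset ω (-l)).indicator (fun _ => ((haar D).real (U D l) : ℂ)) ν := by
  simp only [mul_comm (conj _), ← chi_sub_right]
  exact setIntegral_chi_left l (ν - ω)

theorem integrableOn_U_of_continuous {f : Vilenkin D → ℂ} (hf : Continuous f) (l : ℤ) :
    IntegrableOn f (U D l) (haar D) :=
  hf.continuousOn.integrableOn_compact (isCompact_U l)

/-- The inverse Fourier transform of an integrable function on `V*`. -/
noncomputable def invFourier (D : DigitSet M) (g : Vilenkin Ds → ℂ) (x : Vilenkin D) : ℂ :=
  ∫ ω, g ω * chi x ω ∂(haar Ds)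

theorem IsTestFun.invFourier {l k : ℤ} {g : Vilenkin Ds → ℂ} (hg : IsTestFun l k g) :
    IsTestFun k l (invFourier D g) where
  apply_add x u hu := by
    refine integral_congr_ae (Eventually.of_forall fun ω => ?_)
    by_cases hω : ω ∈ U Ds (-k)
    · simp only [chi_add_left, chi_eq_one_of_mem_U hu hω (by omega), mul_one]
    · simp only [hg.apply_eq_zero hω, zero_mul]
  support_subset x hx := by
    by_contra h
    obtain ⟨u, hu, hne⟩ := exists_chi_ne_one_right (Ds := Ds) h
    have hinvariant := integral_add_right_eq_self (μ := haar Ds) (fun ω => g ω * chi x ω) u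
    simp only [hg.apply_add _ u hu, chi_add_right, ← mul_assoc, integral_mul_const] at hinvariant
    exact hne ((mul_eq_left₀ hx).1 hinvariant)

theorem IsTestFun.fourier_invFourier {l k : ℤ} {g : Vilenkin Ds → ℂ} (hg : IsTestFun l k g) :
    fourier Ds (GenVilenkin.invFourier D g) = g := by
  ext ω
  have hconj : Continuous fun x : Vilenkin D => conj (chi x ω) :=
    Complex.continuous_conj.comp (continuous_chi_left ω)
  have hcoset : ∀ ν, g ν * ∫ x in U D (-l), conj (chi x ω) * chi x ν ∂(haar D)
      = (coset ω l).indicator (fun _ => g ω * ((haar D).real (U D (-l)) : ℂ)) ν := by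
    intro ν
    rw [setIntegral_conj_chi_mul_chi_left, neg_neg]
    by_cases hν : ν ∈ coset ω l
    · rw [Set.indicator_of_mem hν, Set.indicator_of_mem hν, hg.apply_eq_of_mem_coset hν]
    · rw [Set.indicator_of_notMem hν, Set.indicator_of_notMem hν, mul_zero]
  calc fourier Ds (GenVilenkin.invFourier D g) ω
      = ∫ x in U D (-l), conj (chi x ω) * ∫ ν, g ν * chi x ν ∂(haar Ds) ∂(haar D) := by
        simp only [mul_comm (conj _)]
        exact (setIntegral_eq_integral_of_forall_compl_eq_zero fun x hx =>
          mul_eq_zero_of_left (hg.invFourier.apply_eq_zero hx) _).symm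
    _ = ∫ ν, g ν * ∫ x in U D (-l), conj (chi x ω) * chi x ν ∂(haar D) ∂(haar Ds) :=
        integral_mul_integral_kernel_comm (integrableOn_U_of_continuous hconj _) hg.integrable
          continuous_chi.aestronglyMeasurable fun x ν => (norm_chi x ν).le
    _ = g ω := by
        simp only [hcoset]
        rw [integral_indicator (measurableSet_coset ω l), setIntegral_const, Measure.real,
          haar_coset, ← Measure.real, Complex.real_smul, mul_left_comm, ← Complex.ofReal_mul,
          mul_comm ((haar Ds).real _), haar_real_U_neg_mul_haar_real_U, Complex.ofReal_one, mul_one]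

end Fourier

section FourierUniqueness

variable {d : ℕ} {M : Matrix (Fin d) (Fin d) ℤ} {D : DigitSet M} {Ds : DigitSet M.transpose}

theorem setIntegral_chi_mul_fourier {f : Vilenkin D → ℂ} (hf : Integrable f (haar D))
    (x : Vilenkin D) (l : ℤ) :
    ∫ ω in U Ds (-l), chi x ω * fourier Ds f ω ∂(haar Ds)
      = (∫ y in coset x l, f y ∂(haar D)) * ((haar Ds).real (U Ds (-l)) : ℂ) := by
  have hcoset : ∀ y, f y * ∫ ω in U Ds (-l), chi x ω * conj (chi y ω) ∂(haar Ds)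
      = (coset x l).indicator (fun y => f y * ((haar Ds).real (U Ds (-l)) : ℂ)) y := by
    intro y
    have hmem : x ∈ coset y l ↔ y ∈ coset x l := by simp only [mem_coset_iff, eq_comm]
    simp only [mul_comm (chi x _)]
    rw [setIntegral_conj_chi_mul_chi_right, neg_neg]
    by_cases hy : y ∈ coset x l
    · rw [Set.indicator_of_mem hy, Set.indicator_of_mem (hmem.2 hy)]
    · rw [Set.indicator_of_notMem hy, Set.indicator_of_notMem (mt hmem.1 hy), mul_zero]
  have hconj : Continuous fun p : Vilenkin D × Vilenkin Ds => conj (chi p.1 p.2) :=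
    Complex.continuous_conj.comp continuous_chi
  calc ∫ ω in U Ds (-l), chi x ω * fourier Ds f ω ∂(haar Ds)
      = ∫ y, f y * ∫ ω in U Ds (-l), chi x ω * conj (chi y ω) ∂(haar Ds) ∂(haar D) :=
        (integral_mul_integral_kernel_comm hf
          (integrableOn_U_of_continuous (continuous_chi_right x) _) hconj.aestronglyMeasurable
          fun y ω => ((RCLike.norm_conj _).trans (norm_chi y ω)).le).symm
    _ = (∫ y in coset x l, f y ∂(haar D)) * ((haar Ds).real (U Ds (-l)) : ℂ) := by
        simp only [hcoset]
        rw [integral_indicator (measurableSet_coset x l), integral_mul_const]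

theorem haar_coset_ne_top (x : Vilenkin D) (l : ℤ) : haar D (coset x l) ≠ ∞ := by
  rw [haar_coset]
  exact haar_U_ne_top l

theorem IsFourierL2.setIntegral_chi_mul {φ : L2 D} {g : Vilenkin Ds → ℂ} (h : IsFourierL2 φ g)
    (x : Vilenkin D) (l : ℤ) :
    ∫ ω in U Ds (-l), chi x ω * g ω ∂(haar Ds)
      = (∫ y in coset x l, φ y ∂(haar D)) * ((haar Ds).real (U Ds (-l)) : ℂ) := by
  obtain ⟨hg, u, hu, hlim, hF⟩ := h
  have : IsFiniteMeasure ((haar Ds).restrict (U Ds (-l))) :=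
    isFiniteMeasure_restrict.2 (haar_U_ne_top _)
  have hcoset : Tendsto (fun k => ∫ y in coset x l, u k y ∂(haar D)) atTop
      (𝓝 (∫ y in coset x l, φ y ∂(haar D))) := by
    simp only [← L2.inner_indicatorConstLp_one (𝕜 := ℂ) (measurableSet_coset x l)
      (haar_coset_ne_top x l)]
    exact tendsto_const_nhds.inner hlim
  have hF' : Tendsto (fun k => eLpNorm (fun ω => fourier Ds (u k) ω - g ω) 2
      ((haar Ds).restrict (U Ds (-l)))) atTop (𝓝 0) :=
    tendsto_of_tendsto_of_tendsto_of_le_of_le tendsto_const_nhds hF (fun _ => zero_le)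
      fun _ => eLpNorm_mono_measure _ Measure.restrict_le_self
  have hfourier := tendsto_integral_mul_of_tendsto_eLpNorm
    (continuous_chi_right (Ds := Ds) x).aestronglyMeasurable (fun ω => (norm_chi x ω).le)
    ((hg.restrict _).integrable one_le_two)
    (fun k => integrableOn_U_of_continuous (continuous_fourier (hu k)) _) hF'
  simp only [setIntegral_chi_mul_fourier (hu _)] at hfourier
  exact tendsto_nhds_unique hfourier (hcoset.mul_const _)

theorem IsFourierL2.unique {φ ψ : L2 D} {g : Vilenkin Ds → ℂ} (hφ : IsFourierL2 φ g)
    (hψ : IsFourierL2 ψ g) : φ = ψ := by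
  have hint : ∀ (f : L2 D) (x : Vilenkin D) (l : ℤ), IntegrableOn f (coset x l) (haar D) :=
    fun f x l => integrableOn_Lp_of_measure_ne_top f one_le_two (haar_coset_ne_top x l)
  have hne : ∀ l : ℤ, ((haar Ds).real (U Ds (-l)) : ℂ) ≠ 0 := fun l =>
    Complex.ofReal_ne_zero.2
      (right_ne_zero_of_mul_eq_one (haar_real_U_neg_mul_haar_real_U D Ds (-l)))
  rw [← sub_eq_zero, Lp.eq_zero_iff_ae_eq_zero]
  refine ae_eq_zero_of_setIntegral_coset_eq_zero
    (fun l => coset_zero (D := D) l ▸ hint _ 0 l) fun x l => ?_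
  rw [integral_congr_ae (ae_restrict_of_ae (Lp.coeFn_sub φ ψ))]
  simp only [Pi.sub_apply]
  rw [integral_sub (hint φ x l) (hint ψ x l), sub_eq_zero]
  refine mul_right_cancel₀ (hne l) ?_
  rw [← hφ.setIntegral_chi_mul, ← hψ.setIntegral_chi_mul]

theorem IsTestFun.isFourierL2 {l k : ℤ} {g : Vilenkin Ds → ℂ} (hg : IsTestFun l k g) {φ : L2 D}
    (hφ : φ =ᵐ[haar D] GenVilenkin.invFourier D g) : IsFourierL2 φ g := by
  refine ⟨hg.memLp 2, fun _ => φ, fun _ => hg.invFourier.integrable.congr hφ.symm,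
    tendsto_const_nhds, ?_⟩
  simp only [fourier_congr_ae hφ, hg.fourier_invFourier, sub_self, eLpNorm_zero',
    tendsto_const_nhds]

theorem IsTestFun.isFourierL2_iff {l k : ℤ} {g : Vilenkin Ds → ℂ} (hg : IsTestFun l k g)
    {φ : L2 D} : IsFourierL2 φ g ↔ φ =ᵐ[haar D] GenVilenkin.invFourier D g := by
  refine ⟨fun h => ?_, hg.isFourierL2⟩
  have hmem := hg.invFourier.memLp (D := D) 2
  rw [h.unique (hg.isFourierL2 hmem.coeFn_toLp)]
  exact hmem.coeFn_toLp

end FourierUniqueness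

section Walsh

variable {d : ℕ} {M : Matrix (Fin d) (Fin d) ℤ} {D : DigitSet M} {Ds : DigitSet M.transpose} {n : ℕ}

/-- The element with the coordinates `w_0, …, w_{n-1}` at the places `1, …, n` and zeros elsewhere;
it embeds the words of length `n` into the group. -/
noncomputable def ofWord (w : Fin n → Digit D) : Vilenkin D :=
  ⟨fun j => if h : 1 ≤ j ∧ j ≤ n then w ⟨(j - 1).toNat, by omega⟩ else 0,
    1, fun j hj => dif_neg (by omega)⟩

theorem ofWord_apply (w : Fin n → Digit D) (j : ℤ) : (ofWord w) j =
    if h : 1 ≤ j ∧ j ≤ n then w ⟨(j - 1).toNat, by omega⟩ else 0 := rfl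

theorem ofWord_add (w w' : Fin n → Digit D) : ofWord (w + w') = ofWord w + ofWord w' := by
  refine vilenkin_ext fun j => ?_
  rw [coe_add, ofWord_apply, ofWord_apply, ofWord_apply]
  split_ifs
  · rfl
  · rw [add_zero]

theorem ofWord_zero : ofWord (0 : Fin n → Digit D) = 0 := by
  refine vilenkin_ext fun j => ?_
  rw [ofWord_apply]
  split_ifs <;> rfl

theorem ofWord_word_apply (x : Vilenkin D) {j : ℤ} (h1 : 1 ≤ j) (hn : j ≤ n) :
    (ofWord (word n x 1)) j = x j := by
  rw [ofWord_apply, dif_pos ⟨h1, hn⟩]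
  exact congrArg x.1 (by simp only; omega)

theorem gam_mem_H (k : ℕ) : gam D k ∈ H D := fun _ hj => if_pos hj

theorem gam_apply_neg (k i : ℕ) :
    (gam D k) (-(i : ℤ)) = D.nthDigit (k / M.det.natAbs ^ i) := by
  change (if 0 < -(i : ℤ) then 0 else D.nthDigit (k / M.det.natAbs ^ (- -(i : ℤ)).toNat)) = _
  rw [if_neg (by omega), neg_neg, Int.toNat_natCast]

theorem gam_mem_U {k : ℕ} (hk : k < M.det.natAbs ^ n) : gam D k ∈ U D (-n) := by
  intro j hj
  obtain ⟨i, rfl⟩ : ∃ i : ℕ, j = -(i : ℤ) := ⟨(-j).toNat, by omega⟩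
  rw [gam_apply_neg, Nat.div_eq_of_lt (hk.trans_le (Nat.pow_le_pow_right D.m_pos (by omega))),
    D.nthDigit_zero]

theorem mod_eq_of_nthDigit_eq {k k' : ℕ} (h : D.nthDigit k = D.nthDigit k') :
    k % M.det.natAbs = k' % M.det.natAbs := by
  by_contra hne
  refine D.incongruent ⟨k % M.det.natAbs, Nat.mod_lt _ D.m_pos⟩
    ⟨k' % M.det.natAbs, Nat.mod_lt _ D.m_pos⟩ (fun h' => hne (congrArg Fin.val h')) ⟨0, ?_⟩
  rw [Matrix.mulVec_zero, sub_eq_zero]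
  exact congrArg Subtype.val h

theorem gam_fin_injective (D : DigitSet M) (n : ℕ) :
    Function.Injective fun k : Fin (M.det.natAbs ^ n) => gam D k := by
  intro k k' h
  refine finFunctionFinEquiv.symm.injective (funext fun i => Fin.ext ?_)
  apply mod_eq_of_nthDigit_eq (D := D)
  rw [← gam_apply_neg, ← gam_apply_neg]
  exact congrArg (fun x : Vilenkin D => x (-(i : ℤ))) h

theorem chi_ofWord_word {x : Vilenkin D} (hx : x ∈ H D) (hxn : x ∈ U D (-n)) (ω : Vilenkin Ds) :
    chi x (ofWord (word n ω 1)) = chi x ω := by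
  have h : chi x (ω - ofWord (word n ω 1)) = 1 := by
    refine chi_eq_one fun j => ?_
    by_cases hj : -n < j ∧ j ≤ 0
    · right
      rw [coe_sub, ofWord_word_apply ω (by omega) (by omega), sub_self]
    · left
      rcases not_and_or.1 hj with hj | hj
      · exact hxn j (by omega)
      · exact hx j (by omega)
  rw [← sub_add_cancel ω (ofWord (word n ω 1)), chi_add_right, h, one_mul, sub_add_cancel]

/-- The character `w ↦ χ(x, w)` of the finite group of words of length `n`. Walsh functions are
linearly independent because distinct characters of this group are. -/
noncomputable def wordChar (Ds : DigitSet M.transpose) (n : ℕ) (x : Vilenkin D) :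
    AddChar (Fin n → Digit Ds) ℂ where
  toFun w := chi x (ofWord w)
  map_zero_eq_one' := by rw [ofWord_zero, chi_zero_right]
  map_add_eq_mul' w w' := by rw [ofWord_add, chi_add_right]

theorem eq_of_forall_chi_eq {x y : Vilenkin D} (h : ∀ ω : Vilenkin Ds, chi x ω = chi y ω) :
    x = y := by
  refine vilenkin_ext fun j => ?_
  by_contra hj
  have hnot : x - y ∉ U D (-(-j)) := fun hu => hj (sub_eq_zero.1 (hu j (by omega)))
  obtain ⟨ω, -, hne⟩ := exists_chi_ne_one_right (Ds := Ds) hnot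
  rw [chi_sub_left, h, mul_comm, conj_chi_mul_self] at hne
  exact hne rfl

theorem wordChar_gam_injective (D : DigitSet M) (Ds : DigitSet M.transpose) (n : ℕ) :
    Function.Injective fun k : Fin (M.det.natAbs ^ n) => wordChar Ds n (gam D k) := by
  intro k k' h
  refine gam_fin_injective D n (eq_of_forall_chi_eq (Ds := Ds) fun ω => ?_)
  have hword : chi (gam D k) (ofWord (word n ω 1)) = chi (gam D k') (ofWord (word n ω 1)) :=
    DFunLike.congr_fun h (word n ω 1)
  rwa [chi_ofWord_word (gam_mem_H _) (gam_mem_U k.2),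
    chi_ofWord_word (gam_mem_H _) (gam_mem_U k'.2)] at hword

theorem span_wordChar_gam (D : DigitSet M) (Ds : DigitSet M.transpose) (n : ℕ) :
    Submodule.span ℂ (Set.range fun k : Fin (M.det.natAbs ^ n) =>
      (wordChar Ds n (gam D k) : (Fin n → Digit Ds) → ℂ)) = ⊤ := by
  have : Fintype (Digit Ds) := Fintype.ofFinite _
  have hindep : LinearIndependent ℂ fun k : Fin (M.det.natAbs ^ n) =>
      (wordChar Ds n (gam D k) : (Fin n → Digit Ds) → ℂ) :=
    (AddChar.linearIndependent (Fin n → Digit Ds) ℂ).comp _ (wordChar_gam_injective D Ds n)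
  refine hindep.span_eq_top_of_card_eq_finrank' ?_
  rw [Module.finrank_fintype_fun_eq_card, Fintype.card_fin, Fintype.card_fun, Fintype.card_fin,
    ← Nat.card_eq_fintype_card, card_digit, Matrix.det_transpose]

theorem isWalshPolynomial_mask (D : DigitSet M) (b : (Fin n → Digit Ds) → ℂ) :
    IsWalshPolynomial D Ds n (mask b) := by
  have hb : b ∈ Submodule.span ℂ (Set.range fun k : Fin (M.det.natAbs ^ n) =>
      (wordChar Ds n (gam D k) : (Fin n → Digit Ds) → ℂ)) := by
    rw [span_wordChar_gam]
    trivial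
  obtain ⟨c, hc⟩ := Submodule.mem_span_range_iff_exists_fun ℂ |>.1 hb
  refine ⟨fun k => if h : k < M.det.natAbs ^ n then c ⟨k, h⟩ else 0, fun ω => ?_⟩
  rw [← Fin.sum_univ_eq_sum_range (fun k => (if h : k < M.det.natAbs ^ n then c ⟨k, h⟩ else 0) *
    chi (gam D k) ω), mask, ← hc, Finset.sum_apply]
  refine Finset.sum_congr rfl fun k _ => ?_
  rw [dif_pos k.2, Pi.smul_apply, smul_eq_mul,
    ← chi_ofWord_word (gam_mem_H _) (gam_mem_U k.2) ω]
  rfl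

end Walsh

section Refinable

variable {d : ℕ} {M : Matrix (Fin d) (Fin d) ℤ} {D : DigitSet M} {Ds : DigitSet M.transpose}

theorem map_dil_haar (D : DigitSet M) (k : ℤ) :
    (haar D).map (dil k) = haar D (U D k) • haar D := by
  have : ((haar D).map (dil k)).IsAddHaarMeasure :=
    (dilEquiv D k).isAddHaarMeasure_map (haar D) (continuous_dil k) (continuous_dil (-k))
  have hU : (haar D).map (dil k) (compactU D) = haar D (U D k) := by
    refine (Measure.map_apply (continuous_dil k).measurable (measurableSet_U 0)).trans ?_
    congr 1
    ext x
    rw [Set.mem_preimage, dil_mem_U, zero_add]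
  rw [← hU]
  exact Measure.addHaarMeasure_unique _ _

theorem quasiMeasurePreserving_dil (D : DigitSet M) (k : ℤ) :
    Measure.QuasiMeasurePreserving (dil k) (haar D) (haar D) :=
  ⟨(continuous_dil k).measurable, map_dil_haar D k ▸ Measure.smul_absolutelyContinuous⟩

theorem integral_comp_dil (f : Vilenkin D → ℂ) (k : ℤ) :
    ∫ x, f (dil k x) ∂(haar D) = (haar D).real (U D k) * ∫ x, f x ∂(haar D) := by
  let e : Vilenkin D ≃ᵐ Vilenkin D :=
    { toEquiv := (dilEquiv D k).toEquiv
      measurable_toFun := (continuous_dil k).measurable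
      measurable_invFun := (continuous_dil (-k)).measurable }
  calc ∫ x, f (dil k x) ∂(haar D)
      = ∫ x, f x ∂((haar D).map (dil k)) := (integral_map_equiv e f).symm
    _ = (haar D).real (U D k) * ∫ x, f x ∂(haar D) := by
        rw [map_dil_haar, integral_smul_measure, Complex.real_smul, Measure.real]

theorem ae_eq_comp_dil_add {X : Type*} {φ f : Vilenkin D → X} (h : φ =ᵐ[haar D] f) (k : ℤ)
    (y : Vilenkin D) : (fun x => φ (dil k x + y)) =ᵐ[haar D] fun x => f (dil k x + y) :=
  ((measurePreserving_add_right (haar D) y).quasiMeasurePreserving.comp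
    (quasiMeasurePreserving_dil D k)).ae_eq_comp h

theorem integrable_mul_chi {g : Vilenkin Ds → ℂ} (hg : Integrable g (haar Ds)) (x : Vilenkin D) :
    Integrable (fun ω => g ω * chi x ω) (haar Ds) :=
  hg.mul_bdd (continuous_chi_right x).aestronglyMeasurable
    (Eventually.of_forall fun ω => (norm_chi x ω).le)

theorem invFourier_eq_sum_of_refinement {n : ℕ} {g m₀ : Vilenkin Ds → ℂ}
    (hg : Integrable g (haar Ds)) {β : ℕ → ℂ}
    (hm₀ : ∀ ω, m₀ ω = ∑ k ∈ Finset.range n, β k * chi (gam D k) ω)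
    (hrec : ∀ ω, g ω = m₀ (dil (-1) ω) * g (dil (-1) ω)) (x : Vilenkin D) :
    invFourier D g x = ∑ k ∈ Finset.range n,
      (haar Ds).real (U Ds (-1)) * β k * invFourier D g (dil 1 x + gam D k) := by
  have hpoint : ∀ ω, g ω * chi x ω = ∑ k ∈ Finset.range n,
      β k * (g (dil (-1) ω) * chi (dil 1 x + gam D k) (dil (-1) ω)) := by
    intro ω
    rw [hrec ω, hm₀, ← chi_dil 1 x ω, Finset.sum_mul, Finset.sum_mul]
    refine Finset.sum_congr rfl fun k _ => ?_
    rw [chi_add_left]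
    ring
  calc invFourier D g x
      = ∫ ω, ∑ k ∈ Finset.range n,
          β k * (g (dil (-1) ω) * chi (dil 1 x + gam D k) (dil (-1) ω)) ∂(haar Ds) :=
        integral_congr_ae (Eventually.of_forall hpoint)
    _ = (haar Ds).real (U Ds (-1)) * ∫ ω, ∑ k ∈ Finset.range n,
          β k * (g ω * chi (dil 1 x + gam D k) ω) ∂(haar Ds) :=
        integral_comp_dil (fun ω => ∑ k ∈ Finset.range n,
          β k * (g ω * chi (dil 1 x + gam D k) ω)) (-1)
    _ = ∑ k ∈ Finset.range n,
          (haar Ds).real (U Ds (-1)) * β k * invFourier D g (dil 1 x + gam D k) := by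
        rw [integral_finsetSum _ fun k _ => (integrable_mul_chi hg _).const_mul _, Finset.mul_sum]
        simp only [integral_const_mul, mul_assoc, invFourier]

theorem isRefinable_of_ae_eq_invFourier {n : ℕ} {g m₀ : Vilenkin Ds → ℂ}
    (hg : Integrable g (haar Ds)) (hm₀ : IsWalshPolynomial D Ds n m₀)
    (hrec : ∀ ω, g ω = m₀ (dil (-1) ω) * g (dil (-1) ω)) {φ : L2 D}
    (hφ : φ =ᵐ[haar D] invFourier D g) : IsRefinable φ := by
  obtain ⟨β, hβ⟩ := hm₀
  refine ⟨fun k => if k < M.det.natAbs ^ n then (haar Ds).real (U Ds (-1)) * β k else 0, ?_⟩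
  filter_upwards [hφ, ae_all_iff.2 fun k => ae_eq_comp_dil_add hφ 1 (gam D k)] with x hx hshift
  rw [hx, invFourier_eq_sum_of_refinement hg hβ hrec, Finset.sum_congr rfl fun k hk => by
    rw [← hshift k, ← if_pos (c := k < M.det.natAbs ^ n) (t := _ * β k) (e := 0)
      (Finset.mem_range.1 hk)]]
  exact hasSum_sum_of_ne_finset_zero fun k hk => by
    rw [if_neg fun h => hk (Finset.mem_range.2 h), zero_mul]

end Refinable

section Orthogonality

variable {d : ℕ} {M : Matrix (Fin d) (Fin d) ℤ} {D : DigitSet M} {Ds : DigitSet M.transpose}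

theorem fourier_comp_add (f : Vilenkin D → ℂ) (h : Vilenkin D) (ω : Vilenkin Ds) :
    fourier Ds (fun x => f (x + h)) ω = chi h ω * fourier Ds f ω := by
  calc fourier Ds (fun x => f (x + h)) ω
      = ∫ x, f x * conj (chi (x - h) ω) ∂(haar D) := by
        rw [fourier, ← integral_add_right_eq_self (μ := haar D) (fun x => f x * _) h]
        simp only [add_sub_cancel_right]
    _ = chi h ω * fourier Ds f ω := by
        simp only [chi_sub_left, map_mul, Complex.conj_conj, ← mul_assoc]
        rw [integral_mul_const, mul_comm, fourier]

theorem integral_conj_translate_mul_translate {l k : ℤ} {g : Vilenkin Ds → ℂ}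
    (hg : IsTestFun l k g) (h h' : Vilenkin D) :
    ∫ x, conj (invFourier D g (x + h)) * invFourier D g (x + h') ∂(haar D)
      = ∫ ω, conj (g ω) * g ω * chi (h' - h) ω ∂(haar Ds) := by
  have hconj : Integrable (fun x => conj (invFourier D g (x + h))) (haar D) :=
    (Complex.conjLIE.toContinuousLinearEquiv.toContinuousLinearMap).integrable_comp
      (hg.invFourier.integrable.comp_add_right h)
  have hright : ∀ x : Vilenkin D, invFourier D g (x + h')
      = ∫ ω, g ω * chi h' ω * chi x ω ∂(haar Ds) := by
    intro x
    simp only [invFourier, chi_add_left, mul_comm (chi x _), mul_assoc]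
  have hleft : ∀ ω : Vilenkin Ds, ∫ x, conj (invFourier D g (x + h)) * chi x ω ∂(haar D)
      = conj (chi h ω * g ω) := by
    intro ω
    rw [← congrFun (hg.fourier_invFourier (D := D)) ω, ← fourier_comp_add, fourier, ← integral_conj]
    simp only [map_mul, Complex.conj_conj]
  simp only [hright]
  rw [integral_mul_integral_kernel_comm hconj (integrable_mul_chi hg.integrable h')
    continuous_chi.aestronglyMeasurable fun x ω => (norm_chi x ω).le]
  refine integral_congr_ae (Eventually.of_forall fun ω => ?_)
  simp only [hleft, map_mul, chi_sub_left]
  ring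

theorem translate_ae_eq {φ : L2 D} {f : Vilenkin D → ℂ} (h : φ =ᵐ[haar D] f) (y : Vilenkin D) :
    translate φ y =ᵐ[haar D] fun x => f (x + y) :=
  (Lp.coeFn_compMeasurePreserving φ (measurePreserving_add_right (haar D) y)).trans
    ((measurePreserving_add_right (haar D) y).quasiMeasurePreserving.ae_eq_comp h)

theorem inner_translate {φ : L2 D} {f : Vilenkin D → ℂ} (hφ : φ =ᵐ[haar D] f)
    (h h' : Vilenkin D) :
    inner ℂ (translate φ h) (translate φ h')
      = ∫ x, conj (f (x + h)) * f (x + h') ∂(haar D) := by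
  rw [L2.inner_def]
  refine integral_congr_ae ?_
  filter_upwards [translate_ae_eq hφ h, translate_ae_eq hφ h'] with x hx hx'
  rw [hx, hx', RCLike.inner_apply, mul_comm]

theorem sub_mem_U_zero_iff_of_mem_H {h h' : Vilenkin D} (hh : h ∈ H D) (hh' : h' ∈ H D) :
    h' - h ∈ U D 0 ↔ h = h' := by
  refine ⟨fun hsub => vilenkin_ext fun j => ?_, fun heq => ?_⟩
  · rcases le_or_gt j 0 with hj | hj
    · exact (sub_eq_zero.1 (hsub j hj)).symm
    · rw [hh j hj, hh' j hj]
  · rw [heq, sub_self]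
    exact zero_mem_U D 0

theorem sub_mem_H {h h' : Vilenkin D} (hh : h ∈ H D) (hh' : h' ∈ H D) : h - h' ∈ H D :=
  fun j hj => by rw [coe_sub, hh j hj, hh' j hj, sub_self]

theorem orthonormal_translate {l k : ℤ} {g : Vilenkin Ds → ℂ} (hg : IsTestFun l k g)
    (hint : ∀ h ∈ H D, ∫ ω, conj (g ω) * g ω * chi h ω ∂(haar Ds)
      = ∫ ω in U Ds 0, chi h ω ∂(haar Ds))
    {φ : L2 D} (hφ : φ =ᵐ[haar D] invFourier D g) :
    Orthonormal ℂ (fun h : H D => translate φ h.1) := by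
  classical
  rw [orthonormal_iff_ite]
  rintro ⟨h, hh⟩ ⟨h', hh'⟩
  rw [inner_translate hφ, integral_conj_translate_mul_translate hg, hint _ (sub_mem_H hh' hh),
    setIntegral_chi_right, Set.indicator_apply, Measure.real, haar_U, ENNReal.toReal_one,
    Complex.ofReal_one, neg_zero]
  exact if_congr ((sub_mem_U_zero_iff_of_mem_H hh hh').trans Subtype.mk_eq_mk.symm) rfl rfl

-- For `h ∈ H` the function `chi h` is invariant under shifts by `H*`, so each difference integrates
-- to zero.
theorem integral_add_sum_sub_translate_mul_chi {ι : Type*} (S : Finset ι) {f : Vilenkin Ds → ℂ}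
    {F : ι → Vilenkin Ds → ℂ} (hf : Integrable f (haar Ds)) (hF : ∀ i, Integrable (F i) (haar Ds))
    {η : ι → Vilenkin Ds} (hη : ∀ i, η i ∈ H Ds) {h : Vilenkin D} (hh : h ∈ H D) :
    ∫ ω, (f ω + ∑ i ∈ S, (F i ω - F i (ω + η i))) * chi h ω ∂(haar Ds)
      = ∫ ω, f ω * chi h ω ∂(haar Ds) := by
  have hchi : ∀ i ω, F i (ω + η i) * chi h ω = F i (ω + η i) * chi h (ω + η i) := fun i ω => by
    rw [chi_add_right, chi_eq_one_of_mem_H hh (hη i), mul_one]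
  have hFchi : ∀ i, Integrable (fun ω => F i ω * chi h ω) (haar Ds) := fun i =>
    integrable_mul_chi (hF i) h
  have hdiff : ∀ i, Integrable (fun ω => F i ω * chi h ω - F i (ω + η i) * chi h (ω + η i))
      (haar Ds) := fun i => (hFchi i).sub ((hFchi i).comp_add_right (η i))
  simp only [add_mul, Finset.sum_mul, sub_mul, hchi]
  rw [integral_add (integrable_mul_chi hf h) (integrable_finsetSum _ fun i _ => hdiff i),
    integral_finsetSum _ fun i _ => hdiff i, add_eq_left]
  refine Finset.sum_eq_zero fun i _ => ?_
  rw [integral_sub (hFchi i) ((hFchi i).comp_add_right (η i)),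
    integral_add_right_eq_self (fun ω => F i ω * chi h ω), sub_self]

end Orthogonality

section MaskProduct

variable {d : ℕ} {A : Matrix (Fin d) (Fin d) ℤ} {Ds : DigitSet A} {n r : ℕ}
  {ξ : Fin (r + 1) → Digit Ds} {b : (Fin n → Digit Ds) → ℂ}

/-- The word of length `n - 1` of `a` at `s` is none of the windows `ξ_k … ξ_{k+n-2}`,
`1 ≤ k ≤ r - n + 2`. -/
def AvoidsWindows (n : ℕ) (ξ : Fin (r + 1) → Digit Ds) (a : ℤ → Digit Ds) (s : ℤ) : Prop :=
  ∀ k : ℕ, 1 ≤ k → k + n ≤ r + 2 → word (n - 1) a s ≠ word (n - 1) (ext ξ) k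

theorem ext_of_neg {l : ℤ} (h : l < 0) : ext ξ l = 0 := dif_neg (by omega)

theorem ext_ne_zero (hξ : ∀ i, ξ i ≠ 0) {l : ℤ} (h : 0 ≤ l) (h' : l ≤ r) : ext ξ l ≠ 0 := by
  rw [ext, dif_pos ⟨h, h'⟩]
  exact hξ _

theorem word_eq_word_iff {p : ℕ} {a c : ℤ → Digit Ds} {s t : ℤ} :
    word p a s = word p c t ↔ ∀ i : ℕ, i < p → a (s + i) = c (t + i) :=
  ⟨fun h i hi => congrFun h ⟨i, hi⟩, fun h => funext fun i => h i i.2⟩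

theorem apply_eq_of_word_eq {p : ℕ} (hp : 1 ≤ p) {a c : ℤ → Digit Ds} {s t : ℤ}
    (h : word p a s = word p c t) : a s = c t := by
  simpa using word_eq_word_iff.1 h 0 hp

theorem word_eq_word_iff_head_tail (hn : 1 ≤ n) {a c : ℤ → Digit Ds} {s t : ℤ} :
    word n a s = word n c t ↔
      a s = c t ∧ word (n - 1) a (s + 1) = word (n - 1) c (t + 1) := by
  simp only [word_eq_word_iff]
  constructor
  · refine fun h => ⟨by simpa using h 0 (by omega), fun i hi => ?_⟩
    simpa only [Nat.cast_add, Nat.cast_one, add_assoc, add_comm (1 : ℤ)] using h (i + 1) (by omega)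
  · rintro ⟨h0, h⟩ (_ | i) hi
    · simpa using h0
    · simpa only [Nat.cast_add, Nat.cast_one, add_assoc, add_comm (1 : ℤ)] using h i (by omega)

theorem word_eq_word_of_head_of_tail {p : ℕ} {a c : ℤ → Digit Ds} {s t : ℤ} (h0 : a s = c t)
    (h : word p a (s + 1) = word p c (t + 1)) : word p a s = word p c t := by
  have hword : word (p + 1) a s = word (p + 1) c t :=
    (word_eq_word_iff_head_tail (by omega)).2 ⟨h0, h⟩
  exact word_eq_word_iff.2 fun i hi => word_eq_word_iff.1 hword i (by omega)

theorem word_eq_zero {p : ℕ} {a : ℤ → Digit Ds} {s : ℤ} (h : ∀ i < s + p, a i = 0) :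
    word p a s = fun _ => 0 :=
  funext fun i => h _ (by have := i.2; omega)

theorem isChainWord_word_iff (hn : 1 ≤ n) {a : ℤ → Digit Ds} {s : ℤ} :
    IsChainWord ξ (word n a s) ↔ ∃ k : ℕ, k + n ≤ r + 1 ∧ a s = ext ξ k ∧
      word (n - 1) a (s + 1) = word (n - 1) (ext ξ) ((k + 1 : ℕ) : ℤ) := by
  simp only [IsChainWord, word_eq_word_iff_head_tail hn]
  push_cast
  rfl

theorem isZeroWord_word_iff (hn : 1 ≤ n) {a : ℤ → Digit Ds} {s : ℤ} :
    IsZeroWord ξ (word n a s) ↔ a s = 0 ∧ AvoidsWindows n ξ a (s + 1) := by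
  have htail : (fun i : Fin (n - 1) => word n a s ⟨i.val + 1, by omega⟩)
      = word (n - 1) a (s + 1) := by
    funext i
    simp only [word, Nat.cast_add, Nat.cast_one, add_assoc, add_comm (1 : ℤ)]
  rw [IsZeroWord, htail]
  refine and_congr_left fun _ => ⟨fun h => ?_, fun h i hi => ?_⟩
  · simpa [word] using h ⟨0, by omega⟩ rfl
  · simp [word, hi, h]

theorem avoidsWindows_of_apply_eq_zero (hn : 2 ≤ n) (hξ : ∀ i, ξ i ≠ 0) {a : ℤ → Digit Ds}
    {s : ℤ} (h : a s = 0) : AvoidsWindows n ξ a s := fun k _ hkr heq =>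
  ext_ne_zero hξ (by omega) (by omega) (h ▸ apply_eq_of_word_eq (by omega) heq).symm

theorem eq_of_word_ext_eq (hn : 2 ≤ n) (hξ : ∀ i, ξ i ≠ 0) (hw : DistinctWindows n ξ)
    {l : ℤ} {k : ℕ} (hl : l + n ≤ r + 2) (hk : 1 ≤ k) (hkr : k + n ≤ r + 2)
    (h : word (n - 1) (ext ξ) l = word (n - 1) (ext ξ) k) : l = k := by
  rcases lt_or_ge l 0 with hneg | hnonneg
  · exact absurd h (avoidsWindows_of_apply_eq_zero hn hξ (ext_of_neg hneg) k hk hkr)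
  · lift l to ℕ using hnonneg
    by_contra hne
    exact hw l k (by omega) hkr (by exact_mod_cast hne) h

theorem avoidsWindows_ext (hn : 2 ≤ n) (hξ : ∀ i, ξ i ≠ 0)
    (hw : DistinctWindows n ξ) {s : ℤ} (hs : s ≤ 0) : AvoidsWindows n ξ (ext ξ) s :=
  fun k hk hkr h => by
    have := eq_of_word_ext_eq hn hξ hw (by omega) hk hkr h
    omega

theorem apply_eq_ext_of_mask_word_ne_zero (hn : 2 ≤ n) (hξ : ∀ i, ξ i ≠ 0)
    (hw : DistinctWindows n ξ) (hb : IsAssociatedMask ξ b) {a : ℤ → Digit Ds} {s l : ℤ}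
    (hl : l + n ≤ r + 2) (hne : b (word n a s) ≠ 0)
    (htail : word (n - 1) a (s + 1) = word (n - 1) (ext ξ) l) : a s = ext ξ (l - 1) := by
  by_contra hcon
  refine hne (hb.other _ ?_ ?_)
  · rw [isChainWord_word_iff (by omega)]
    rintro ⟨k, hk, hhead, htail'⟩
    have := eq_of_word_ext_eq hn hξ hw hl (by omega) (by omega) (htail.symm.trans htail')
    exact hcon (hhead.trans (congrArg _ (by omega)))
  · rw [isZeroWord_word_iff (by omega)]
    rintro ⟨hhead, havoid⟩
    rcases lt_or_ge 0 l with hpos | hnonpos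
    · lift l to ℕ using hpos.le
      exact havoid l (by omega) (by omega) htail
    · exact hcon (hhead.trans (ext_of_neg (by omega)).symm)

theorem apply_eq_zero_of_mask_word_ne_zero (hn : 1 ≤ n) (hb : IsAssociatedMask ξ b)
    {a : ℤ → Digit Ds} {s : ℤ} (hne : b (word n a s) ≠ 0) (h : AvoidsWindows n ξ a (s + 1)) :
    a s = 0 := by
  by_contra hcon
  refine hne (hb.other _ ?_ fun hzero => hcon ((isZeroWord_word_iff hn).1 hzero).1)
  rw [isChainWord_word_iff hn]
  rintro ⟨k, hk, -, htail⟩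
  exact h (k + 1) (by omega) (by omega) htail

theorem norm_mask_word_of_avoidsWindows (hn : 1 ≤ n) (hb : IsAssociatedMask ξ b)
    {a : ℤ → Digit Ds} {s : ℤ} (h0 : a s = 0) (h : AvoidsWindows n ξ a (s + 1)) :
    ‖b (word n a s)‖ = 1 := by
  rcases hb.zeroFirst _ ((isZeroWord_word_iff hn).2 ⟨h0, h⟩) with h | h <;> simp [h]

theorem norm_mask_word_ext (hn : 2 ≤ n) (hξ : ∀ i, ξ i ≠ 0) (hw : DistinctWindows n ξ)
    (hb : IsAssociatedMask ξ b) {s : ℤ} (hs : s + n ≤ r + 1) :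
    ‖b (word n (ext ξ) s)‖ = 1 := by
  rcases lt_or_ge s 0 with hneg | hnonneg
  · exact norm_mask_word_of_avoidsWindows (by omega) hb (ext_of_neg hneg)
      (avoidsWindows_ext hn hξ hw (by omega))
  · lift s to ℕ using hnonneg
    rcases hb.chain _ ⟨s, by omega, rfl⟩ with h | h <;> simp [h]

theorem mask_dil (b : (Fin n → Digit Ds) → ℂ) (ω : Vilenkin Ds) (k : ℤ) :
    mask b (dil k ω) = b (word n ω (1 + k)) :=
  congrArg b (funext fun i => congrArg ω.1 (by ring))

theorem exists_mask_dil_eq_one (hb : b (fun _ => 0) = 1) (ω : Vilenkin Ds) :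
    ∃ N : ℕ, ∀ j ≥ N, mask b (dil (-((j : ℤ) + 1)) ω) = 1 := by
  obtain ⟨l, hl⟩ := exists_mem_U ω
  refine ⟨(n - l).toNat, fun j hj => ?_⟩
  rw [mask_dil, word_eq_zero fun i hi => hl i (by omega), hb]

theorem maskProd_eq_prod (hb : b (fun _ => 0) = 1) {ω : Vilenkin Ds} {N : ℕ}
    (h : ∀ i < (n : ℤ) - N, ω i = 0) :
    maskProd b ω = ∏ j ∈ Finset.Icc 1 N, b (word n ω (1 - (j : ℤ))) := by
  rw [maskProd, tprod_eq_prod (s := Finset.range N), ← Finset.Ico_add_one_right_eq_Icc,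
    Finset.prod_Ico_eq_prod_range, Nat.add_sub_cancel]
  · exact Finset.prod_congr rfl fun j _ => by rw [mask_dil]; congr 2; push_cast; ring
  · intro j hj
    rw [Finset.mem_range, not_lt] at hj
    rw [mask_dil, word_eq_zero fun i hi => h i (by omega), hb]

theorem maskProd_eq_mask_mul (hb : b (fun _ => 0) = 1) (ω : Vilenkin Ds) :
    maskProd b ω = mask b (dil (-1) ω) * maskProd b (dil (-1) ω) := by
  obtain ⟨N, hN⟩ := exists_mask_dil_eq_one hb ω
  have hmul : Multipliable fun j : ℕ => mask b (dil (-(((j + 1 : ℕ) : ℤ) + 1)) ω) :=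
    multipliable_of_ne_finset_one (s := Finset.range N) fun j hj =>
      hN (j + 1) (by rw [Finset.mem_range] at hj; omega)
  have hsplit := tprod_eq_zero_mul' (f := fun j : ℕ => mask b (dil (-((j : ℤ) + 1)) ω)) hmul
  have hdil (j : ℕ) :
      dil (-(((j + 1 : ℕ) : ℤ) + 1)) ω = dil (-((j : ℤ) + 1)) (dil (-1) ω) :=
    vilenkin_ext fun i => congrArg ω.1 (by push_cast; ring)
  simp only [hdil, Nat.cast_zero, zero_add] at hsplit
  exact hsplit

theorem mask_word_ne_zero_of_maskProd_ne_zero (hb : b (fun _ => 0) = 1) {ω : Vilenkin Ds}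
    (h : maskProd b ω ≠ 0) {s : ℤ} (hs : s ≤ 0) : b (word n ω s) ≠ 0 := by
  obtain ⟨l, hl⟩ := exists_mem_U ω
  rw [maskProd_eq_prod (N := max (n - l).toNat (1 - s).toNat) hb fun i hi => hl i (by omega),
    Finset.prod_ne_zero_iff] at h
  have := h (1 - s).toNat (Finset.mem_Icc.2 ⟨by omega, le_max_right _ _⟩)
  rwa [show 1 - (((1 - s).toNat : ℕ) : ℤ) = s by omega] at this

theorem mem_coset_chainPoint_iff {k : ℕ} {ω : Vilenkin Ds} :
    ω ∈ coset (chainPoint n ξ k) ((n : ℤ) - 1) ↔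
      ∀ j ≤ (n : ℤ) - 1, ω j = ext ξ (j + k - 1) := by
  rw [mem_coset_iff]
  exact forall₂_congr fun j hj => by
    rw [show (chainPoint n ξ k) j = ext ξ (j + k - 1) from if_pos hj]

theorem word_eq_of_mem_coset_chainPoint {k : ℕ} {ω : Vilenkin Ds}
    (h : ω ∈ coset (chainPoint n ξ k) ((n : ℤ) - 1)) :
    word (n - 1) ω 1 = word (n - 1) (ext ξ) k :=
  word_eq_word_iff.2 fun i hi => by
    rw [mem_coset_chainPoint_iff.1 h _ (by omega)]
    exact congrArg _ (by ring)

theorem mem_Q_add_U (hn : 1 ≤ n) {ω : Vilenkin Ds} :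
    ω ∈ Q n ξ + U Ds ((n : ℤ) - 1) ↔ ω ∈ U Ds 0 ∧ AvoidsWindows n ξ ω 1 := by
  have hword : ∀ {x y : Vilenkin Ds}, (∀ j ≤ (n : ℤ) - 1, x j = y j) →
      word (n - 1) x 1 = word (n - 1) y 1 := fun h =>
    word_eq_word_iff.2 fun i hi => h _ (by omega)
  constructor
  · rintro ⟨q, ⟨h0, -, hq⟩, u, hu, rfl⟩
    have hqu : ∀ j ≤ (n : ℤ) - 1, (q + u) j = q j := fun j hj => by
      rw [coe_add, hu j hj, add_zero]
    exact ⟨fun j hj => (hqu j (by omega)).trans (h0 j hj), fun k hk hkr =>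
      (hword hqu).trans_ne (hq k hk hkr)⟩
  · rintro ⟨h0, hq⟩
    have htrunc : ∀ j ≤ (n : ℤ) - 1, trunc ((n : ℤ) - 1) ω j = ω j := fun j hj => if_pos hj
    refine ⟨trunc ((n : ℤ) - 1) ω, ⟨fun j hj => (htrunc j (by omega)).trans (h0 j hj),
      fun j hj => if_neg (by omega), fun k hk hkr => (hword htrunc).trans_ne (hq k hk hkr)⟩,
      ω - trunc ((n : ℤ) - 1) ω, fun j hj => ?_, add_sub_cancel _ _⟩
    rw [coe_sub, htrunc j hj, sub_self]

theorem mem_coset_chainPoint_of_maskProd_ne_zero (hn : 2 ≤ n) (hξ : ∀ i, ξ i ≠ 0)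
    (hw : DistinctWindows n ξ) (hb : IsAssociatedMask ξ b) {ω : Vilenkin Ds}
    (h : maskProd b ω ≠ 0) {k : ℕ} (hkr : k + n ≤ r + 2)
    (hk : word (n - 1) ω 1 = word (n - 1) (ext ξ) k) :
    ω ∈ coset (chainPoint n ξ k) ((n : ℤ) - 1) := by
  have hback : ∀ i : ℕ,
      word (n - 1) ω (1 - (i : ℤ)) = word (n - 1) (ext ξ) ((k : ℤ) - i) := by
    intro i
    induction i with
    | zero => simpa using hk
    | succ i ih =>
      rw [Nat.cast_succ, ← sub_sub, ← sub_sub, sub_right_comm, sub_self, zero_sub]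
      rw [← neg_add_eq_sub] at ih
      refine word_eq_word_of_head_of_tail ?_ (by rwa [sub_add_cancel])
      exact apply_eq_ext_of_mask_word_ne_zero hn hξ hw hb (by omega)
        (mask_word_ne_zero_of_maskProd_ne_zero hb.zero h (by omega)) ih
  rw [mem_coset_chainPoint_iff]
  intro j hj
  rcases le_or_gt j 1 with hj1 | hj1
  · convert apply_eq_of_word_eq (by omega) (hback (1 - j).toNat) using 2 <;> omega
  · convert word_eq_word_iff.1 hk (j - 1).toNat (by omega) using 2 <;> omega

theorem mem_U_zero_of_maskProd_ne_zero (hn : 2 ≤ n) (hξ : ∀ i, ξ i ≠ 0)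
    (hb : IsAssociatedMask ξ b) {ω : Vilenkin Ds} (h : maskProd b ω ≠ 0)
    (havoid : AvoidsWindows n ξ ω 1) : ω ∈ U Ds 0 := by
  have hstep : ∀ s ≤ 0, AvoidsWindows n ξ ω (s + 1) → ω s = 0 := fun s hs =>
    apply_eq_zero_of_mask_word_ne_zero (by omega) hb
      (mask_word_ne_zero_of_maskProd_ne_zero hb.zero h hs)
  have hback : ∀ i : ℕ, ω (-(i : ℤ)) = 0 := by
    intro i
    induction i with
    | zero => exact hstep _ (by simp) (by simpa using havoid)
    | succ i ih =>
      refine hstep _ (by omega) (avoidsWindows_of_apply_eq_zero hn hξ ?_)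
      rwa [Nat.cast_succ, neg_add_rev, neg_add_cancel_comm]
  intro j hj
  simpa [Int.toNat_of_nonneg (neg_nonneg.2 hj)] using hback (-j).toNat

theorem maskProd_of_mem_coset_chainPoint (hb : b (fun _ => 0) = 1) {k : ℕ} {ω : Vilenkin Ds}
    (h : ω ∈ coset (chainPoint n ξ k) ((n : ℤ) - 1)) :
    maskProd b ω = ∏ j ∈ Finset.Icc 1 (k + n - 1), b (word n (ext ξ) ((k : ℤ) - j)) := by
  rw [mem_coset_chainPoint_iff] at h
  rw [maskProd_eq_prod (N := k + n - 1) hb fun i hi => by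
    rw [h i (by omega), ext_of_neg (by omega)]]
  refine Finset.prod_congr rfl fun j hj => congrArg b (word_eq_word_iff.2 fun i hi => ?_)
  rw [Finset.mem_Icc] at hj
  rw [h _ (by omega)]
  exact congrArg _ (by ring)

theorem maskProd_of_mem_U_zero (hb : b (fun _ => 0) = 1) {ω : Vilenkin Ds} (h : ω ∈ U Ds 0) :
    maskProd b ω = ∏ j ∈ Finset.Icc 1 (n - 1), b (word n ω (1 - (j : ℤ))) :=
  maskProd_eq_prod hb fun i hi => h i (by omega)

theorem norm_maskProd_of_mem_coset_chainPoint (hn : 2 ≤ n) (hξ : ∀ i, ξ i ≠ 0)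
    (hw : DistinctWindows n ξ) (hb : IsAssociatedMask ξ b) {k : ℕ} (hk : k + n ≤ r + 2)
    {ω : Vilenkin Ds} (h : ω ∈ coset (chainPoint n ξ k) ((n : ℤ) - 1)) : ‖maskProd b ω‖ = 1 := by
  rw [maskProd_of_mem_coset_chainPoint hb.zero h, norm_prod]
  refine Finset.prod_eq_one fun j hj => norm_mask_word_ext hn hξ hw hb ?_
  rw [Finset.mem_Icc] at hj
  omega

theorem norm_maskProd_of_mem_U_zero (hn : 2 ≤ n) (hξ : ∀ i, ξ i ≠ 0)
    (hb : IsAssociatedMask ξ b) {ω : Vilenkin Ds} (h : ω ∈ U Ds 0)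
    (havoid : AvoidsWindows n ξ ω 1) : ‖maskProd b ω‖ = 1 := by
  rw [maskProd_of_mem_U_zero hb.zero h, norm_prod]
  refine Finset.prod_eq_one fun j hj => ?_
  rw [Finset.mem_Icc] at hj
  refine norm_mask_word_of_avoidsWindows (by omega) hb (h _ (by omega)) ?_
  rcases hj.1.eq_or_lt with rfl | hj1
  · simpa using havoid
  · exact avoidsWindows_of_apply_eq_zero hn hξ (h _ (by omega))

theorem sum_Icc_eq_of_word_eq (hr : n ≤ r) (hw : DistinctWindows n ξ) {a : ℤ → Digit Ds} {s : ℤ}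
    {k : ℕ} (hk : 1 ≤ k) (hkr : k + n ≤ r + 2) (h : word (n - 1) a s = word (n - 1) (ext ξ) k)
    {F : ℕ → ℂ} (hF : ∀ i : ℕ, word (n - 1) a s ≠ word (n - 1) (ext ξ) i → F i = 0) :
    ∑ i ∈ Finset.Icc 1 (r - n + 2), F i = F k := by
  refine Finset.sum_eq_single k (fun i hi hik => hF i ?_) fun hk' => absurd ?_ hk'
  · rw [Finset.mem_Icc] at hi
    exact h.trans_ne (hw k i hkr (by omega) hik.symm)
  · exact Finset.mem_Icc.2 ⟨hk, by omega⟩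

theorem sum_Icc_eq_zero_of_avoidsWindows (hr : n ≤ r) {a : ℤ → Digit Ds} {s : ℤ}
    (h : AvoidsWindows n ξ a s) {F : ℕ → ℂ}
    (hF : ∀ i : ℕ, word (n - 1) a s ≠ word (n - 1) (ext ξ) i → F i = 0) :
    ∑ i ∈ Finset.Icc 1 (r - n + 2), F i = 0 :=
  Finset.sum_eq_zero fun i hi => by
    rw [Finset.mem_Icc] at hi
    exact hF i (h i hi.1 (by omega))

theorem exists_word_eq_or_avoidsWindows (n : ℕ) (ξ : Fin (r + 1) → Digit Ds) (a : ℤ → Digit Ds)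
    (s : ℤ) :
    (∃ k : ℕ, 1 ≤ k ∧ k + n ≤ r + 2 ∧ word (n - 1) a s = word (n - 1) (ext ξ) k) ∨
      AvoidsWindows n ξ a s := by
  by_contra! h
  exact h.2 h.1

theorem maskProd_eq_explicitFourier (hn : 2 ≤ n) (hr : n ≤ r) (hξ : ∀ i, ξ i ≠ 0)
    (hw : DistinctWindows n ξ) (hb : IsAssociatedMask ξ b) (ω : Vilenkin Ds) :
    maskProd b ω = explicitFourier ξ b ω := by
  classical
  have hF : ∀ k : ℕ, word (n - 1) ω 1 ≠ word (n - 1) (ext ξ) k →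
      ω ∉ coset (chainPoint n ξ k) ((n : ℤ) - 1) := fun k hk h =>
    hk (word_eq_of_mem_coset_chainPoint h)
  simp only [explicitFourier, Set.indicator_apply, singleton_add_U,
    mem_Q_add_U (show 1 ≤ n by omega), ite_mul, one_mul, zero_mul]
  rcases exists_word_eq_or_avoidsWindows n ξ ω 1 with ⟨k, hk1, hkr, hk⟩ | havoid
  · rw [if_neg fun h => h.2 k hk1 hkr hk, add_zero,
      sum_Icc_eq_of_word_eq hr hw hk1 hkr hk fun i hi => if_neg (hF i hi)]
    split_ifs with h
    · exact maskProd_of_mem_coset_chainPoint hb.zero h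
    · by_contra hne
      exact h (mem_coset_chainPoint_of_maskProd_ne_zero hn hξ hw hb hne hkr hk)
  · rw [sum_Icc_eq_zero_of_avoidsWindows hr havoid fun i hi => if_neg (hF i hi), zero_add]
    split_ifs with h
    · rw [maskProd_of_mem_U_zero hb.zero h.1]
      have hcut : (fun l => if l ≤ 0 then 0 else ω l) = fun l => ω l :=
        funext fun l => ite_eq_right_iff.2 fun hl => (h.1 l hl).symm
      rw [hcut]
    · by_contra hne
      exact h ⟨mem_U_zero_of_maskProd_ne_zero hn hξ hb hne havoid, havoid⟩

theorem maskProd_add_of_mem_U (b : (Fin n → Digit Ds) → ℂ) (ω : Vilenkin Ds) {u : Vilenkin Ds}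
    (hu : u ∈ U Ds ((n : ℤ) - 1)) : maskProd b (ω + u) = maskProd b ω := by
  refine tprod_congr fun j => ?_
  rw [mask_dil, mask_dil]
  refine congrArg b (word_eq_word_iff.2 fun i hi => ?_)
  rw [coe_add, hu _ (by omega), add_zero]

theorem isTestFun_maskProd (hn : 2 ≤ n) (hr : n ≤ r) (hξ : ∀ i, ξ i ≠ 0)
    (hw : DistinctWindows n ξ) (hb : IsAssociatedMask ξ b) :
    IsTestFun ((n : ℤ) - 1) ((r : ℤ) - n + 2) (maskProd b) where
  apply_add ω _ hu := maskProd_add_of_mem_U b ω hu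
  support_subset ω hω j hj := by
    rcases exists_word_eq_or_avoidsWindows n ξ ω 1 with ⟨k, -, hkr, hk⟩ | havoid
    · have hchain := mem_coset_chainPoint_of_maskProd_ne_zero hn hξ hw hb hω hkr hk
      rw [mem_coset_chainPoint_iff.1 hchain j (by omega), ext_of_neg (by omega)]
    · exact mem_U_zero_of_maskProd_ne_zero hn hξ hb hω havoid j (by omega)

/-- The element `ξ_0 … ξ_{k-1} , 0 0 …` of `H*`, by which the coset of `chainPoint n ξ k` differs
from a subset of `U*`. -/
noncomputable def chainInt (n : ℕ) (ξ : Fin (r + 1) → Digit Ds) (k : ℕ) : Vilenkin Ds :=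
  trunc 0 (chainPoint n ξ k)

theorem chainInt_mem_H (k : ℕ) : chainInt n ξ k ∈ H Ds := fun _ hj => if_neg (by omega)

theorem chainInt_apply_of_nonpos (hn : 1 ≤ n) (k : ℕ) {j : ℤ} (hj : j ≤ 0) :
    chainInt n ξ k j = ext ξ (j + k - 1) :=
  (if_pos hj).trans (if_pos (by omega))

theorem add_chainInt_mem_coset_chainPoint_iff (hn : 1 ≤ n) {k : ℕ} {ω : Vilenkin Ds} :
    ω + chainInt n ξ k ∈ coset (chainPoint n ξ k) ((n : ℤ) - 1) ↔
      ω ∈ U Ds 0 ∧ word (n - 1) ω 1 = word (n - 1) (ext ξ) k := by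
  rw [mem_coset_chainPoint_iff, word_eq_word_iff]
  constructor
  · refine fun h => ⟨fun j hj => ?_, fun i hi => ?_⟩
    · simpa [chainInt_apply_of_nonpos hn k hj] using h j (by omega)
    · have := h (1 + i) (by omega)
      rw [coe_add, chainInt_mem_H k _ (by omega), add_zero] at this
      exact this.trans (congrArg _ (by ring))
  · rintro ⟨h0, h⟩ j hj
    rcases le_or_gt j 0 with hj0 | hj0
    · rw [coe_add, chainInt_apply_of_nonpos hn k hj0, h0 j hj0, zero_add]
    · rw [coe_add, chainInt_mem_H k j hj0, add_zero]
      convert h (j - 1).toNat (by omega) using 2 <;> omega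

theorem conj_mul_self_eq_indicator {X : Type*} {f : X → ℂ} {s : Set X} {x : X}
    (hnorm : x ∈ s → ‖f x‖ = 1) (hsupp : f x ≠ 0 → x ∈ s) :
    conj (f x) * f x = s.indicator (fun _ => (1 : ℂ)) x := by
  by_cases hx : x ∈ s
  · rw [Complex.conj_mul', hnorm hx, Set.indicator_of_mem hx, Complex.ofReal_one, one_pow]
  · rw [not_imp_comm.1 hsupp hx, mul_zero, Set.indicator_of_notMem hx]

theorem conj_maskProd_mul_self (hn : 2 ≤ n) (hr : n ≤ r) (hξ : ∀ i, ξ i ≠ 0)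
    (hw : DistinctWindows n ξ) (hb : IsAssociatedMask ξ b) (ω : Vilenkin Ds) :
    conj (maskProd b ω) * maskProd b ω = (U Ds 0).indicator (fun _ => (1 : ℂ)) ω +
      ∑ k ∈ Finset.Icc 1 (r - n + 2),
        ((coset (chainPoint n ξ k) ((n : ℤ) - 1)).indicator (fun _ => (1 : ℂ)) ω -
          (coset (chainPoint n ξ k) ((n : ℤ) - 1)).indicator (fun _ => (1 : ℂ))
            (ω + chainInt n ξ k)) := by
  have hF : ∀ k : ℕ, word (n - 1) ω 1 ≠ word (n - 1) (ext ξ) k →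
      (coset (chainPoint n ξ k) ((n : ℤ) - 1)).indicator (fun _ => (1 : ℂ)) ω -
        (coset (chainPoint n ξ k) ((n : ℤ) - 1)).indicator (fun _ => (1 : ℂ))
          (ω + chainInt n ξ k) = 0 := fun k hk => by
    rw [Set.indicator_of_notMem fun h => hk (word_eq_of_mem_coset_chainPoint h),
      Set.indicator_of_notMem fun h =>
        hk ((add_chainInt_mem_coset_chainPoint_iff (by omega)).1 h).2, sub_zero]
  rcases exists_word_eq_or_avoidsWindows n ξ ω 1 with ⟨k, hk1, hkr, hk⟩ | havoid
  · have hU : (coset (chainPoint n ξ k) ((n : ℤ) - 1)).indicator (fun _ => (1 : ℂ))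
        (ω + chainInt n ξ k) = (U Ds 0).indicator (fun _ => 1) ω :=
      Set.indicator_eq_indicator ((add_chainInt_mem_coset_chainPoint_iff (by omega)).trans
        (and_iff_left hk)) rfl
    rw [sum_Icc_eq_of_word_eq hr hw hk1 hkr hk hF, hU, add_sub_cancel]
    exact conj_mul_self_eq_indicator
      (norm_maskProd_of_mem_coset_chainPoint hn hξ hw hb hkr)
      fun h => mem_coset_chainPoint_of_maskProd_ne_zero hn hξ hw hb h hkr hk
  · rw [sum_Icc_eq_zero_of_avoidsWindows hr havoid hF, add_zero]
    exact conj_mul_self_eq_indicator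
      (fun h => norm_maskProd_of_mem_U_zero hn hξ hb h havoid)
      fun h => mem_U_zero_of_maskProd_ne_zero hn hξ hb h havoid

end MaskProduct

section MaskProductIntegral

variable {d : ℕ} {M : Matrix (Fin d) (Fin d) ℤ} {D : DigitSet M} {Ds : DigitSet M.transpose}
  {n r : ℕ} {ξ : Fin (r + 1) → Digit Ds} {b : (Fin n → Digit Ds) → ℂ}

theorem integral_conj_maskProd_mul_self_mul_chi (hn : 2 ≤ n) (hr : n ≤ r) (hξ : ∀ i, ξ i ≠ 0)
    (hw : DistinctWindows n ξ) (hb : IsAssociatedMask ξ b) {h : Vilenkin D} (hh : h ∈ H D) :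
    ∫ ω, conj (maskProd b ω) * maskProd b ω * chi h ω ∂(haar Ds)
      = ∫ ω in U Ds 0, chi h ω ∂(haar Ds) := by
  have hcoset (k : ℕ) : Integrable
      ((coset (chainPoint n ξ k) ((n : ℤ) - 1)).indicator fun _ => (1 : ℂ)) (haar Ds) :=
    (integrable_indicator_iff (measurableSet_coset _ _)).2
      (integrableOn_const (haar_coset_ne_top _ _))
  have hU : Integrable ((U Ds 0).indicator fun _ => (1 : ℂ)) (haar Ds) :=
    (integrable_indicator_iff (measurableSet_U 0)).2 (integrableOn_const (haar_U_ne_top 0))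
  classical
  simp only [conj_maskProd_mul_self hn hr hξ hw hb]
  rw [integral_add_sum_sub_translate_mul_chi _ hU hcoset (fun k => chainInt_mem_H k) hh,
    ← integral_indicator (measurableSet_U 0)]
  simp only [Set.indicator_apply, ite_mul, one_mul, zero_mul]

end MaskProductIntegral

end GenVilenkin

open GenVilenkin in
theorem theorem7_general {d : ℕ} {M : Matrix (Fin d) (Fin d) ℤ} (D : DigitSet M)
    (Ds : DigitSet M.transpose) (n r : ℕ) (hn : 2 ≤ n) (hr : n ≤ r)
    (ξ : Fin (r + 1) → Digit Ds) (hξ : ∀ i, ξ i ≠ 0) (hw : DistinctWindows n ξ)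
    (b : (Fin n → Digit Ds) → ℂ) (hb : IsAssociatedMask ξ b) :
    IsWalshPolynomial D Ds n (mask b) ∧
    (∃! φ : L2 D, IsFourierL2 φ (maskProd b)) ∧
    ∀ φ : L2 D, IsFourierL2 φ (maskProd b) →
      IsOrthogonalRefinable φ ∧
      (∃ f ∈ TestFun D ((r : ℤ) - n + 2) ((n : ℤ) - 1), φ =ᵐ[haar D] f) ∧
      Integrable φ (haar D) ∧
      ∀ ω : Vilenkin Ds,
        fourier Ds φ ω = maskProd b ω ∧ fourier Ds φ ω = explicitFourier ξ b ω := by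
  have hwalsh : IsWalshPolynomial D Ds n (mask b) := isWalshPolynomial_mask D b
  have hg := isTestFun_maskProd hn hr hξ hw hb
  have hf := hg.invFourier (D := D)
  have hexists := hg.isFourierL2 (hf.memLp 2).coeFn_toLp
  refine ⟨hwalsh, ⟨_, hexists, fun ψ hψ => hψ.unique hexists⟩, fun φ hφ => ?_⟩
  have hφf : φ =ᵐ[haar D] invFourier D (maskProd b) := hg.isFourierL2_iff.1 hφ
  have hfourier (ω : Vilenkin Ds) : fourier Ds φ ω = maskProd b ω := by
    rw [fourier_congr_ae hφf, hg.fourier_invFourier]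
  have hrefinable : IsRefinable φ :=
    isRefinable_of_ae_eq_invFourier hg.integrable hwalsh (maskProd_eq_mask_mul hb.zero) hφf
  have horthonormal : Orthonormal ℂ (fun h : H D => translate φ h.1) :=
    orthonormal_translate hg
      (fun _ hh => integral_conj_maskProd_mul_self_mul_chi hn hr hξ hw hb hh) hφf
  exact ⟨⟨hrefinable, horthonormal⟩, ⟨_, hf.mem_testFun, hφf⟩, hf.integrable.congr hφf.symm,
    fun ω => ⟨hfourier ω, (hfourier ω).trans (maskProd_eq_explicitFourier hn hr hξ hw hb ω)⟩⟩

theorem theorem7 {d : ℕ} {M : Matrix (Fin d) (Fin d) ℤ} (hM : GenVilenkin.IsDilation M)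
    (D : GenVilenkin.DigitSet M) (Ds : GenVilenkin.DigitSet M.transpose)
    (n r : ℕ) (hn : 2 ≤ n) (hr : n ≤ r)
    (ξ : Fin (r + 1) → GenVilenkin.Digit Ds) (hξ : ∀ i, ξ i ≠ 0)
    (hw : GenVilenkin.DistinctWindows n ξ)
    (b : (Fin n → GenVilenkin.Digit Ds) → ℂ) (hb : GenVilenkin.IsAssociatedMask ξ b) :
    GenVilenkin.IsWalshPolynomial D Ds n (GenVilenkin.mask b) ∧
    (∃! φ : GenVilenkin.L2 D, GenVilenkin.IsFourierL2 φ (GenVilenkin.maskProd b)) ∧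
    ∀ φ : GenVilenkin.L2 D, GenVilenkin.IsFourierL2 φ (GenVilenkin.maskProd b) →
      GenVilenkin.IsOrthogonalRefinable φ ∧
      (∃ f ∈ GenVilenkin.TestFun D ((r : ℤ) - n + 2) ((n : ℤ) - 1),
        φ =ᵐ[GenVilenkin.haar D] f) ∧
      MeasureTheory.Integrable φ (GenVilenkin.haar D) ∧
      ∀ ω : GenVilenkin.Vilenkin Ds,
        GenVilenkin.fourier Ds φ ω = GenVilenkin.maskProd b ω ∧
        GenVilenkin.fourier Ds φ ω = GenVilenkin.explicitFourier ξ b ω :=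
  theorem7_general D Ds n r hn hr ξ hξ hw b hb
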